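/- All graphs are finite, simple and of nonzero order; $P_b$, $K_n$ and $\square$ denote the path on $b$ vertices, the complete graph on $n$ vertices and the Cartesian product. For a graph $G=(V,E)$ and $S\subseteq V$, color vertices as follows: at time $0$ exactly the vertices of $S$ are colored; in the first timestep every vertex of $N[S]$ becomes colored; in each later timestep every vertex that is the only non-colored neighbor of some colored vertex becomes colored. $S$ is a power dominating set if all of $V$ is eventually colored; then $\operatorname{ppt}(G;S)$ is the number of timesteps after which all of $V$ is colored for the first time (so $\operatorname{ppt}(G;V)=0$). Put $$\operatorname{th}_{\gamma_P}(G)=\min\{|S|+\operatorname{ppt}(G;S): S\text{ is a power dominating set of }G\}.$$ For integers $a\ge 0$, $b\ge 0$, $s\ge 1$ let $\mathcal G(s,a,b)$ be the graph obtained from the disjoint union of $K_s$ and $K_a\,\square\,P_b$ by adding all edges between $K_s$ and the copy of $K_a$ at one fixed end of $P_b$ (so $\mathcal G(s,a,b)\simeq K_s$ if $a=0$ or $b=0$). Path edges are the edges of the copies of $P_b$; complete edges are the edges of $K_s$ and of the copies of $K_a$; cross edges are the edges between $K_s$ and $K_a\,\square\,P_b$; the $a$-vertices are the vertices of $K_a\,\square\,P_b$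 incident to cross edges. **Theorem.** Let $t$ be a positive integer. 1. For every graph $G$, $\operatorname{th}_{\gamma_P}(G)\le t$ if and only if there exist integers $a\ge 0$, $b\ge 0$ and $s\ge 1$ such that $s+b=t$ and $G$ is isomorphic to a graph obtained from $\mathcal G(s,a,b)$ by contracting some (possibly no) path edges, deleting some (possibly no) complete edges, and deleting some (possibly no) cross edges so that every $a$-vertex is incident to at least one remaining cross edge. (After a contraction, parallel edges are identified.) 2. For this fixed $t$, the condition in part 1 can be verified in polynomial time: there is a Turing machine which, given a graph $G$ by its adjacency matrix, decides whether such $a,b,s$ exist, in a number of steps bounded by a polynomial in the length of the input. -/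

import Mathlib

namespace PowerDom

universe u

/-! ### Power domination -/

section PowerDomination

variable {V : Type u} (G : SimpleGraph V)

/-- The closed neighbourhood `N[S]`. -/
def closedNeighborhood (S : Set V) : Set V :=
  {v | v ∈ S ∨ ∃ u ∈ S, G.Adj u v}

/-- One forcing step: a vertex becomes colored if it is the only non-colored neighbor of some
colored vertex. -/
def forceStep (C : Set V) : Set V :=
  {v | v ∈ C ∨ ∃ u ∈ C, ∀ w, (G.Adj u w ∧ w ∉ C) ↔ w = v}

/-- The set of colored vertices after a number of timesteps: initially it is `S`, the first timestep
is the domination step, and every later timestep is a forcing step. -/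
def colored (S : Set V) : ℕ → Set V
  | 0 => S
  | 1 => closedNeighborhood G S
  | k + 2 => forceStep G (colored S (k + 1))

/-- `S` is a power dominating set: it eventually colors every vertex. -/
def IsPowerDominating (S : Set V) : Prop :=
  ∃ k, colored G S k = Set.univ

/-- The power propagation time `ppt(G; S)`, the number of timesteps that a power dominating
set `S` takes to color the whole graph. -/
noncomputable def ppt (S : Set V) : ℕ :=
  sInf {k | colored G S k = Set.univ}

/-- The power domination throttling number: the minimum of `|S| + ppt(G; S)` over all power
dominating sets `S`. The minimum is over a nonempty set when `V` is finite, as the set of all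
vertices is power dominating. -/
noncomputable def throttlingNumber : ℕ :=
  sInf {m | ∃ S : Finset V, IsPowerDominating G (S : Set V) ∧ m = S.card + ppt G (S : Set V)}

end PowerDomination

/-! ### The graph `𝒢(s, a, b)` -/

section BigGraph

/-- The vertices of `𝒢(s, a, b)`: those of `K_s`, and those of `K_a □ P_b`. -/
abbrev BigVertex (s a b : ℕ) : Type := Fin s ⊕ (Fin a × Fin b)

variable (s a b : ℕ)

/-- The path edges: the edges of the `a` copies of `P_b` in `K_a □ P_b`. -/
def pathEdges : Set (Sym2 (BigVertex s a b)) :=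
  {e | ∃ (x : Fin a) (k l : Fin b), (SimpleGraph.pathGraph b).Adj k l ∧
    e = s(Sum.inr (x, k), Sum.inr (x, l))}

/-- The complete edges: the edges of `K_s`, and those of the `b` copies of `K_a` in `K_a □ P_b`. -/
def completeEdges : Set (Sym2 (BigVertex s a b)) :=
  {e | (∃ i j : Fin s, i ≠ j ∧ e = s(Sum.inl i, Sum.inl j)) ∨
    ∃ (x y : Fin a) (k : Fin b), x ≠ y ∧ e = s(Sum.inr (x, k), Sum.inr (y, k))}

/-- The cross edges: all edges between `K_s` and the copy of `K_a` at the first vertex of `P_b`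
(an end copy of `K_a`). -/
def crossEdges : Set (Sym2 (BigVertex s a b)) :=
  {e | ∃ (i : Fin s) (x : Fin a) (k : Fin b), k.val = 0 ∧ e = s(Sum.inl i, Sum.inr (x, k))}

/-- The graph `𝒢(s, a, b)`. If `a = 0` or `b = 0` it is `K_s`. -/
def bigGraph : SimpleGraph (BigVertex s a b) :=
  SimpleGraph.fromEdgeSet (pathEdges s a b ∪ completeEdges s a b ∪ crossEdges s a b)

/-- The `a`-vertices: the vertices of `K_a □ P_b` that are incident to cross edges. -/
def aVertices : Set (BigVertex s a b) :=
  {v | (∃ p, v = Sum.inr p) ∧ ∃ e ∈ crossEdges s a b, v ∈ e}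

end BigGraph

/-! ### Edge operations -/

section Operations

/-- The simple graph `H / F` obtained from `H` by contracting the edges in `F`: two vertices are
identified when they are joined by a walk of edges in `F`, and distinct classes are adjacent when
some edge of `H` joins them. -/
def contractEdges {W : Type*} (H : SimpleGraph W) (F : Set (Sym2 W)) :
    SimpleGraph (SimpleGraph.fromEdgeSet F).ConnectedComponent where
  Adj A B := A ≠ B ∧ ∃ u v : W, (SimpleGraph.fromEdgeSet F).connectedComponentMk u = A ∧
    (SimpleGraph.fromEdgeSet F).connectedComponentMk v = B ∧ H.Adj u v
  symm := ⟨fun _ _ ⟨hne, u, v, hu, hv, h⟩ => ⟨hne.symm, v, u, hv, hu, h.symm⟩⟩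
  loopless := ⟨fun _ h => h.1 rfl⟩

/-- `G` is (isomorphic to a graph) obtained from `𝒢(s, a, b)` by contracting path edges (those
in `P`), deleting complete edges (those in `K`), and deleting cross edges (those in `C`) so that
the remaining cross edges saturate the `a`-vertices. -/
def IsObtainable {V : Type u} (G : SimpleGraph V) (s a b : ℕ) : Prop :=
  ∃ P ⊆ pathEdges s a b, ∃ K ⊆ completeEdges s a b, ∃ C ⊆ crossEdges s a b,
    (∀ v ∈ aVertices s a b, ∃ e ∈ crossEdges s a b \ C, v ∈ e) ∧
    Nonempty (G ≃g contractEdges ((bigGraph s a b).deleteEdges (K ∪ C)) P)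

/-- There are `s ≥ 1` and `a, b ≥ 0` with `s + b = t` such that `G` can be obtained from
`𝒢(s, a, b)` by the three operations. -/
def StructuralCondition {V : Type u} (t : ℕ) (G : SimpleGraph V) : Prop :=
  ∃ s a b : ℕ, 1 ≤ s ∧ s + b = t ∧ IsObtainable G s a b

end Operations

/-! ### Graphs as inputs of an algorithm -/

/-- Graphs of nonzero order as instances of a decision problem: an instance of order `n + 1` has
vertex set `{0, …, n}`. -/
abbrev GraphInstance : Type := Σ n : ℕ, SimpleGraph (Fin (n + 1))

open Classical in
/-- The adjacency matrix, written row by row over the alphabet `{some true, some false, none}`,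
with the separator `none` at the end of each row. -/
noncomputable def encodeGraph (I : GraphInstance) : List (Option Bool) :=
  (List.finRange (I.1 + 1)).flatMap fun i =>
    ((List.finRange (I.1 + 1)).map fun j => some (decide (I.2.Adj i j))) ++ [none]

/-- A property of graphs can be verified in polynomial time: some Turing machine decides it, given
the encoding of the graph, in a number of steps that is polynomial in the input length. -/
def DecidableInPolyTime (p : GraphInstance → Prop) : Prop :=
  ∃ f : GraphInstance → Bool, (∀ I, f I = true ↔ p I) ∧
    Nonempty (Turing.TM2ComputableInPolyTime encodeGraph Computability.encodeBool f)

end PowerDom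

/-!
Both parts rest on the description of `throttlingNumber G ≤ t` by a set `S` of at most `t` vertices
that colors the whole graph within `t - |S|` timesteps (`throttlingNumber_le_iff`).

For the structural characterization, suppose that `S` colors `G` within `b` timesteps. Each vertex
outside `S` lies on exactly one forcing chain, which starts at a vertex colored in the domination
step and proceeds by forces. If `chain x k` denotes the vertex of the chain of `x` that is current
at time `k + 1`, then the chains are quotients of paths on `b` vertices by contraction of edges.
A vertex only forces once all its other neighbors are colored, so two adjacent vertices on
different chains are current at some common time, and adjacent vertices on one chain are consecutive
(`IsSchedule.chain_eq_or_forced`). Hence every edge of `G` comes from an edge of `𝒢(s, a, b)`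
(`isObtainable_of_isSchedule`). Conversely, in a graph obtained from `𝒢(s, a, b)` the vertices of
`K_s` color the first `k` copies of `K_a` within `k` timesteps
(`IsObtainable.exists_colored_eq_univ`).

For the running time, `t` is fixed, so by the description above the property is expressed by a
first-order formula over the graph, with one quantifier for each vertex of `S` and at most two for
each timestep (`definable_colored`). First-order properties are decided in polynomial time, by
induction on formulas (`Definable.and`, `Definable.not`, `Definable.ex`, `Definable.eq`,
`Definable.adj`): vertices are kept in unary on stacks, a quantifier is a loop over all vertices,
and the adjacency matrix is read by skipping rows and symbols (`Prog.runWithin_lookup`). The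
evaluation is written as a structured program on finitely many stacks, and such programs are
compiled into Turing machines of the kind `Turing.TM2`, step by step (`Prog.Run.stepsTo`).
-/

namespace PowerDom

universe u

/-! ### Colored sets and the throttling number -/

section Coloring

variable {V : Type u} (G : SimpleGraph V)

theorem colored_succ_subset (S : Set V) (k : ℕ) : colored G S k ⊆ colored G S (k + 1) := by
  intro v hv
  cases k with
  | zero => exact Or.inl hv
  | succ k => exact Or.inl hv

theorem colored_mono (S : Set V) : Monotone (colored G S) :=
  monotone_nat_of_le_succ (colored_succ_subset G S)

theorem colored_empty (k : ℕ) : colored G ∅ k = ∅ := by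
  induction k with
  | zero => rfl
  | succ k ih =>
    ext v
    cases k with
    | zero => simp [colored, closedNeighborhood]
    | succ k => simp [colored, forceStep, ih]

/-- Since colored sets grow with time, a bound on the throttling number says that some `S` colors
the graph within the remaining `t - |S|` timesteps. -/
theorem throttlingNumber_le_iff [Fintype V] (t : ℕ) :
    throttlingNumber G ≤ t ↔
      ∃ S : Finset V, S.card ≤ t ∧ colored G (S : Set V) (t - S.card) = Set.univ := by
  constructor
  · intro h
    have hne : {m | ∃ S : Finset V, IsPowerDominating G (S : Set V) ∧
        m = S.card + ppt G (S : Set V)}.Nonempty :=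
      ⟨_, Finset.univ, ⟨0, by simp [colored]⟩, rfl⟩
    obtain ⟨S, hS, hm⟩ := Nat.sInf_mem hne
    have hle : S.card + ppt G (S : Set V) ≤ t := hm ▸ h
    refine ⟨S, by omega, Set.eq_univ_of_univ_subset ?_⟩
    have hp : colored G (S : Set V) (ppt G S) = Set.univ := Nat.sInf_mem hS
    exact hp ▸ colored_mono G _ (by omega)
  · rintro ⟨S, hS, hc⟩
    have h₁ : ppt G (S : Set V) ≤ t - S.card := Nat.sInf_le hc
    exact (Nat.sInf_le ⟨S, ⟨_, hc⟩, rfl⟩ : throttlingNumber G ≤ _).trans (by omega)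

end Coloring

/-! ### Contractions and the edges of `𝒢(s, a, b)` -/

section Contraction

variable {V : Type u} {W : Type*}

/-- Being isomorphic to a contraction, in terms of the quotient map: its fibres are the classes of
vertices joined by contracted edges, and its adjacencies are the images of adjacencies. -/
theorem nonempty_iso_contractEdges_iff (G : SimpleGraph V) (H : SimpleGraph W)
    (F : Set (Sym2 W)) :
    Nonempty (G ≃g contractEdges H F) ↔ ∃ f : W → V, Function.Surjective f ∧
      (∀ w w', f w = f w' ↔ (SimpleGraph.fromEdgeSet F).Reachable w w') ∧
      ∀ u v, G.Adj u v ↔ u ≠ v ∧ ∃ w w', f w = u ∧ f w' = v ∧ H.Adj w w' := by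
  constructor
  · rintro ⟨φ⟩
    refine ⟨fun w => φ.symm ((SimpleGraph.fromEdgeSet F).connectedComponentMk w),
      φ.symm.surjective.comp Quot.mk_surjective, fun w w' => ?_, fun u v => ?_⟩
    · rw [φ.symm.injective.eq_iff, SimpleGraph.ConnectedComponent.eq]
    · rw [← φ.map_adj_iff]
      refine and_congr φ.injective.ne_iff ?_
      refine exists_congr fun w => exists_congr fun w' => ?_
      rw [← and_assoc, ← and_assoc]
      refine and_congr_left fun _ => and_congr ?_ ?_
      · exact ⟨fun h => by simp [h], fun h => by simp [← h]⟩
      · exact ⟨fun h => by simp [h], fun h => by simp [← h]⟩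
  · rintro ⟨f, hs, hr, ha⟩
    let g : (SimpleGraph.fromEdgeSet F).ConnectedComponent → V :=
      Quot.lift f fun a b h => (hr a b).2 h
    have hg : Function.Bijective g := by
      refine ⟨?_, fun v => (hs v).imp' (Quot.mk _) fun _ hw => hw⟩
      rintro ⟨x⟩ ⟨y⟩ hxy
      exact Quot.sound ((hr x y).1 hxy)
    refine ⟨RelIso.symm ⟨Equiv.ofBijective g hg, ?_⟩⟩
    intro A B
    change G.Adj (g A) (g B) ↔ _
    rw [ha]
    refine and_congr hg.1.ne_iff ?_
    refine exists_congr fun w => exists_congr fun w' => ?_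
    rw [← and_assoc, ← and_assoc]
    refine and_congr_left fun _ => and_congr ?_ ?_
    · exact (hg.1.eq_iff (a := (SimpleGraph.fromEdgeSet F).connectedComponentMk w))
    · exact (hg.1.eq_iff (a := (SimpleGraph.fromEdgeSet F).connectedComponentMk w'))

/-- A set that is closed under adjacency contains everything reachable from its elements. -/
theorem mem_of_reachable {H : SimpleGraph W} {A : Set W}
    (hA : ∀ u v, H.Adj u v → u ∈ A → v ∈ A) {u v : W} (h : H.Reachable u v) (hu : u ∈ A) :
    v ∈ A := by
  obtain ⟨p⟩ := h
  induction p with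
  | nil => exact hu
  | cons h _ ih => exact ih (hA _ _ h hu)

end Contraction

section BigGraphLemmas

variable {s a b : ℕ}

theorem mem_pathEdges_mk {p q : BigVertex s a b} :
    s(p, q) ∈ pathEdges s a b ↔ ∃ (x : Fin a) (k l : Fin b), p = Sum.inr (x, k) ∧
      q = Sum.inr (x, l) ∧ (k.val + 1 = l.val ∨ l.val + 1 = k.val) := by
  simp only [pathEdges, Set.mem_ofPred_eq, Sym2.eq_iff, SimpleGraph.pathGraph_adj]
  constructor
  · rintro ⟨x, k, l, h, ⟨rfl, rfl⟩ | ⟨rfl, rfl⟩⟩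
    · exact ⟨x, k, l, rfl, rfl, h⟩
    · exact ⟨x, l, k, rfl, rfl, h.symm⟩
  · rintro ⟨x, k, l, rfl, rfl, h⟩
    exact ⟨x, k, l, h, Or.inl ⟨rfl, rfl⟩⟩

theorem mem_completeEdges_mk {p q : BigVertex s a b} :
    s(p, q) ∈ completeEdges s a b ↔
      (∃ i j : Fin s, i ≠ j ∧ p = Sum.inl i ∧ q = Sum.inl j) ∨
      ∃ (x y : Fin a) (k : Fin b), x ≠ y ∧ p = Sum.inr (x, k) ∧ q = Sum.inr (y, k) := by
  simp only [completeEdges, Set.mem_ofPred_eq, Sym2.eq_iff]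
  constructor
  · rintro (⟨i, j, h, ⟨rfl, rfl⟩ | ⟨rfl, rfl⟩⟩ | ⟨x, y, k, h, ⟨rfl, rfl⟩ | ⟨rfl, rfl⟩⟩)
    · exact Or.inl ⟨i, j, h, rfl, rfl⟩
    · exact Or.inl ⟨j, i, h.symm, rfl, rfl⟩
    · exact Or.inr ⟨x, y, k, h, rfl, rfl⟩
    · exact Or.inr ⟨y, x, k, h.symm, rfl, rfl⟩
  · rintro (⟨i, j, h, rfl, rfl⟩ | ⟨x, y, k, h, rfl, rfl⟩)
    · exact Or.inl ⟨i, j, h, Or.inl ⟨rfl, rfl⟩⟩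
    · exact Or.inr ⟨x, y, k, h, Or.inl ⟨rfl, rfl⟩⟩

theorem mem_crossEdges_mk {p q : BigVertex s a b} :
    s(p, q) ∈ crossEdges s a b ↔ ∃ (i : Fin s) (x : Fin a) (k : Fin b), k.val = 0 ∧
      (p = Sum.inl i ∧ q = Sum.inr (x, k) ∨ p = Sum.inr (x, k) ∧ q = Sum.inl i) := by
  simp only [crossEdges, Set.mem_ofPred_eq, Sym2.eq_iff]

theorem bigGraph_deleteEdges_adj {D : Set (Sym2 (BigVertex s a b))} {p q : BigVertex s a b} :
    ((bigGraph s a b).deleteEdges D).Adj p q ↔ (s(p, q) ∈ pathEdges s a b ∨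
      s(p, q) ∈ completeEdges s a b ∨ s(p, q) ∈ crossEdges s a b) ∧ p ≠ q ∧ s(p, q) ∉ D := by
  rw [SimpleGraph.deleteEdges_adj, bigGraph, SimpleGraph.fromEdgeSet_adj, and_assoc]
  simp only [Set.mem_union, or_assoc]

theorem pathEdges_disjoint_delete {K C : Set (Sym2 (BigVertex s a b))}
    (hK : K ⊆ completeEdges s a b) (hC : C ⊆ crossEdges s a b) {e : Sym2 (BigVertex s a b)}
    (he : e ∈ pathEdges s a b) : e ∉ K ∪ C := by
  obtain ⟨x, k, l, h, rfl⟩ := he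
  rw [SimpleGraph.pathGraph_adj] at h
  rintro (h' | h')
  · rcases mem_completeEdges_mk.1 (hK h') with ⟨i, j, -, hi, -⟩ | ⟨x', y', k', hne, h₁, h₂⟩
    · cases hi
    · cases h₁
      cases h₂
      exact hne rfl
  · obtain ⟨i, x, k, -, ⟨h₁, -⟩ | ⟨-, h₁⟩⟩ := mem_crossEdges_mk.1 (hC h') <;> cases h₁

theorem crossEdges_disjoint_completeEdges {e : Sym2 (BigVertex s a b)}
    (he : e ∈ crossEdges s a b) : e ∉ completeEdges s a b := by
  obtain ⟨i, x, k, -, rfl⟩ := he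
  rintro h
  rcases mem_completeEdges_mk.1 h with ⟨_, _, -, -, h⟩ | ⟨_, _, _, -, h, -⟩ <;> cases h

end BigGraphLemmas

/-! ### Coloring a graph obtained from `𝒢(s, a, b)` -/

section Obtainable

variable {V : Type u} {G : SimpleGraph V} {s a b : ℕ}

/-- In a graph obtained from `𝒢(s, a, b)`, the vertices of `K_s` color within `b` timesteps the
whole graph: after `k ≥ 1` timesteps the first `k` copies of `K_a` are colored. -/
theorem IsObtainable.exists_colored_eq_univ (hs : 0 < s) (h : IsObtainable G s a b) :
    ∃ S : Finset V, S.card ≤ s ∧ colored G (S : Set V) b = Set.univ := by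
  classical
  obtain ⟨P, hP, K, hK, C, hC, hsat, hiso⟩ := h
  obtain ⟨f, hsurj, hfib, hadj⟩ := (nonempty_iso_contractEdges_iff _ _ _).1 hiso
  -- contracted edges join vertices of the same path
  have hcol : ∀ x k w, f (Sum.inr (x, k)) = f w → ∃ l, w = Sum.inr (x, l) := by
    intro x k w hw
    refine mem_of_reachable (A := {w | ∃ l, w = Sum.inr (x, l)}) ?_ ((hfib _ _).1 hw) ⟨k, rfl⟩
    rintro u v huv ⟨l, rfl⟩
    obtain ⟨x', k', l', h₁, h₂, -⟩ := mem_pathEdges_mk.1 (hP huv.1)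
    cases h₁
    exact ⟨l', h₂⟩
  -- a path edge that is not contracted separates the classes on its two sides
  have hsep : ∀ x (k l j : Fin b), k.val + 1 = l.val → f (Sum.inr (x, k)) ≠ f (Sum.inr (x, l)) →
      f (Sum.inr (x, k)) = f (Sum.inr (x, j)) → j ≤ k := by
    intro x k l j hkl hne heq
    have : (Sum.inr (x, j) : BigVertex s a b) ∈
        {w : BigVertex s a b | ∃ m, m ≤ k ∧ w = Sum.inr (x, m)} := by
      refine mem_of_reachable ?_ ((hfib _ _).1 heq) ⟨k, le_rfl, rfl⟩
      rintro u v huv ⟨m, hm, rfl⟩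
      obtain ⟨x', k', l', h₁, rfl, h₃⟩ := mem_pathEdges_mk.1 (hP huv.1)
      cases h₁
      by_cases hl : l' ≤ k
      · exact ⟨l', hl, rfl⟩
      · have h₁ : m = k := by
          apply Fin.ext
          have := Fin.le_def.1 hm
          have := Fin.lt_def.1 (not_le.1 hl)
          omega
        subst h₁
        have h₂ : l' = l := by
          apply Fin.ext
          have := Fin.lt_def.1 (not_le.1 hl)
          omega
        subst h₂
        exact absurd ((hfib _ _).2 huv.reachable) hne
    obtain ⟨m, hm, h⟩ := this
    cases h
    exact hm
  set S : Finset V := Finset.univ.image fun i => f (Sum.inl i) with hS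
  have hSmem : ∀ i, f (Sum.inl i) ∈ (S : Set V) := fun i => by simp [hS]
  have hmain : ∀ k x (l : Fin b), l.val < k + 1 →
      f (Sum.inr (x, l)) ∈ colored G (S : Set V) (k + 1) := by
    intro k
    induction k with
    | zero =>
      intro x l hl
      have hl0 : l.val = 0 := by omega
      by_cases hmem : f (Sum.inr (x, l)) ∈ (S : Set V)
      · exact Or.inl hmem
      obtain ⟨e, ⟨he, heC⟩, hv⟩ := hsat (Sum.inr (x, l))
        ⟨⟨_, rfl⟩, s(Sum.inl ⟨0, hs⟩, Sum.inr (x, l)), ⟨_, x, l, hl0, rfl⟩, by simp⟩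
      obtain ⟨i, x', k', hk', rfl⟩ := id he
      obtain ⟨rfl, rfl⟩ : x = x' ∧ l = k' := by simpa using hv
      refine Or.inr ⟨_, hSmem i, (hadj _ _).2 ⟨fun h => hmem (h ▸ hSmem i), _, _, rfl, rfl, ?_⟩⟩
      refine bigGraph_deleteEdges_adj.2 ⟨Or.inr (Or.inr he), by simp, ?_⟩
      rintro (h | h)
      · exact crossEdges_disjoint_completeEdges he (hK h)
      · exact heC h
    | succ k ih =>
      intro x l hl
      rcases Nat.lt_or_ge l.val (k + 1) with hlt | hge
      · exact colored_succ_subset G _ _ (ih x l hlt)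
      have hlk : l.val = k + 1 := by omega
      by_cases hmem : f (Sum.inr (x, l)) ∈ colored G (S : Set V) (k + 1)
      · exact Or.inl hmem
      have hkb : k < b := by have := l.isLt; omega
      have hu := ih x ⟨k, hkb⟩ (Nat.lt_succ_self k)
      have hne : f (Sum.inr (x, ⟨k, hkb⟩)) ≠ f (Sum.inr (x, l)) := fun h => hmem (h ▸ hu)
      have hpath : s(Sum.inr (x, ⟨k, hkb⟩), Sum.inr (x, l)) ∈ pathEdges s a b :=
        mem_pathEdges_mk.2 ⟨x, _, _, rfl, rfl, Or.inl hlk.symm⟩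
      -- the class of `(x, k)` contains no `(x, j)` with `j > k`, so all its neighbors other than
      -- the class of `(x, k + 1)` contain a vertex of `K_s` or of the first `k + 1` copies of `K_a`
      refine Or.inr ⟨_, hu, fun w => ⟨?_, ?_⟩⟩
      · rintro ⟨hw, hwc⟩
        obtain ⟨-, p, p', hp, rfl, hpp'⟩ := (hadj _ _).1 hw
        obtain ⟨j, rfl⟩ := hcol _ _ _ hp.symm
        have hj := Fin.le_def.1 (hsep x ⟨k, hkb⟩ l j hlk.symm hne hp.symm)
        simp only at hj
        rcases (bigGraph_deleteEdges_adj.1 hpp').1 with h | h | h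
        · obtain ⟨x', j', l', h₁, rfl, h₂⟩ := mem_pathEdges_mk.1 h
          cases h₁
          by_cases hl' : l'.val < k + 1
          · exact absurd (ih _ _ hl') hwc
          · obtain rfl : l = l' := Fin.ext (by omega)
            rfl
        · rcases mem_completeEdges_mk.1 h with ⟨i, i', -, h, -⟩ | ⟨x', y, j', -, h₁, rfl⟩
          · cases h
          · cases h₁
            exact absurd (ih y j (by omega)) hwc
        · obtain ⟨i, x', j', -, ⟨h, -⟩ | ⟨-, rfl⟩⟩ := mem_crossEdges_mk.1 h
          · cases h
          · exact absurd (colored_mono G _ (Nat.zero_le _) (hSmem i)) hwc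
      · rintro rfl
        exact ⟨(hadj _ _).2 ⟨hne, _, _, rfl, rfl, bigGraph_deleteEdges_adj.2
          ⟨Or.inl hpath, by simpa [Fin.ext_iff] using by omega,
            pathEdges_disjoint_delete hK hC hpath⟩⟩, hmem⟩
  refine ⟨S, Finset.card_image_le.trans (by simp), Set.eq_univ_of_forall fun v => ?_⟩
  obtain ⟨i | ⟨x, l⟩, rfl⟩ := hsurj v
  · exact colored_mono G _ (Nat.zero_le _) (hSmem i)
  · exact colored_mono G _ l.isLt (hmain l x l (Nat.lt_succ_self _))

end Obtainable

/-! ### Forcing chains -/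

section ForcingChains

variable {V : Type u} {G : SimpleGraph V}

/-- The timestep in which a vertex becomes colored (`0` if it never does). -/
noncomputable def colorTime (G : SimpleGraph V) (S : Set V) (v : V) : ℕ :=
  sInf {k | v ∈ colored G S k}

theorem mem_colored_iff {S : Set V} {b : ℕ} (hb : colored G S b = Set.univ) (v : V) (k : ℕ) :
    v ∈ colored G S k ↔ colorTime G S v ≤ k := by
  refine ⟨fun h => Nat.sInf_le h, fun h => colored_mono G S h ?_⟩
  exact Nat.sInf_mem (s := {k | v ∈ colored G S k}) ⟨b, by simp [hb]⟩

/-- A forcing schedule: `c v` is the timestep in which `v` becomes colored, and for `2 ≤ c v` the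
vertex `pred v` is the one chosen to force `v`. The values of `pred` elsewhere are irrelevant. -/
structure IsSchedule (G : SimpleGraph V) (c : V → ℕ) (pred : V → V) : Prop where
  le_one : ∀ u v, c u = 0 → G.Adj u v → c v ≤ 1
  exists_adj : ∀ v, c v = 1 → ∃ u, c u = 0 ∧ G.Adj u v
  pred_lt : ∀ v, 2 ≤ c v → c (pred v) < c v
  pred_adj : ∀ v, 2 ≤ c v → G.Adj (pred v) v
  eq_of_pred_adj : ∀ v w, 2 ≤ c v → G.Adj (pred v) w → c v ≤ c w → w = v

/-- Choosing one forcing vertex for each vertex colored after the domination step gives a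
schedule. -/
theorem exists_isSchedule {S : Set V} {b : ℕ} (hb : colored G S b = Set.univ) :
    ∃ pred, IsSchedule G (colorTime G S) pred := by
  have key : ∀ v k, colorTime G S v = k + 2 → ∃ u, colorTime G S u < k + 2 ∧ G.Adj u v ∧
      ∀ w, G.Adj u w → k + 2 ≤ colorTime G S w → w = v := by
    intro v k hv
    have hmem := (mem_colored_iff hb v (k + 2)).2 hv.le
    rcases hmem with h | ⟨u, hu, h⟩
    · have := (mem_colored_iff hb _ _).1 h
      omega
    · refine ⟨u, Nat.lt_succ_of_le ((mem_colored_iff hb _ _).1 hu), ((h v).2 rfl).1,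
        fun w hw hk => (h w).1 ⟨hw, fun hc => ?_⟩⟩
      have := (mem_colored_iff hb _ _).1 hc
      omega
  have key' : ∀ v, ∃ u, 2 ≤ colorTime G S v → colorTime G S u < colorTime G S v ∧ G.Adj u v ∧
      ∀ w, G.Adj u w → colorTime G S v ≤ colorTime G S w → w = v := by
    intro v
    by_cases hv : 2 ≤ colorTime G S v
    · obtain ⟨k, hk⟩ := Nat.exists_eq_add_of_le' hv
      obtain ⟨u, hu⟩ := key v k hk
      exact ⟨u, fun _ => hk ▸ hu⟩
    · exact ⟨v, fun h => absurd h hv⟩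
  choose pred hpred using key'
  refine ⟨pred, ⟨fun u v hu h => ?_, fun v hv => ?_, fun v hv => (hpred v hv).1,
    fun v hv => (hpred v hv).2.1, fun v w hv => (hpred v hv).2.2 w⟩⟩
  · exact (mem_colored_iff hb v 1).1 (Or.inr ⟨u, (mem_colored_iff hb u 0).2 hu.le, h⟩)
  · rcases (mem_colored_iff hb v 1).2 hv.le with h | ⟨u, hu, h⟩
    · have := (mem_colored_iff hb v 0).1 h
      omega
    · exact ⟨u, Nat.le_zero.1 ((mem_colored_iff hb u 0).1 hu), h⟩

open Classical in
/-- The forcing chain starting at `x`: its vertex that is responsible for forcing in timestep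
`k + 2`. It stays the same until it forces the next vertex. -/
noncomputable def chain (c : V → ℕ) (pred : V → V) (x : V) : ℕ → V
  | 0 => x
  | k + 1 =>
    if h : ∃ v, c v = k + 2 ∧ pred v = chain c pred x k then h.choose else chain c pred x k

namespace IsSchedule

variable {c : V → ℕ} {pred : V → V} (h : IsSchedule G c pred) {x y : V}

theorem chain_succ (c : V → ℕ) (pred : V → V) (x : V) (k : ℕ) :
    (chain c pred x (k + 1) = chain c pred x k ∧
      ∀ v, pred v = chain c pred x k → c v ≠ k + 2) ∨
    (c (chain c pred x (k + 1)) = k + 2 ∧ pred (chain c pred x (k + 1)) = chain c pred x k) := by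
  rw [chain]
  split_ifs with hv
  · exact Or.inr hv.choose_spec
  · exact Or.inl ⟨rfl, fun v hp hc => hv ⟨v, hc, hp⟩⟩

theorem eq_of_pred_eq (h : IsSchedule G c pred) {v w : V} (hv : 2 ≤ c v) (hvw : c v ≤ c w)
    (hp : pred v = pred w) : w = v :=
  h.eq_of_pred_adj v w hv (hp ▸ h.pred_adj w (hv.trans hvw)) hvw

theorem chain_succ_of_pred (h : IsSchedule G c pred) {v : V} {k : ℕ} (hc : c v = k + 2)
    (hp : pred v = chain c pred x k) : chain c pred x (k + 1) = v := by
  rcases chain_succ c pred x k with ⟨-, h'⟩ | ⟨h₁, h₂⟩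
  · exact absurd hc (h' v hp)
  · exact h.eq_of_pred_eq (by omega) (by omega) (hp.trans h₂.symm)

theorem colorTime_chain (hx : c x = 1) (k : ℕ) :
    1 ≤ c (chain c pred x k) ∧ c (chain c pred x k) ≤ k + 1 := by
  induction k with
  | zero => simp [chain, hx]
  | succ k ih =>
    rcases chain_succ c pred x k with ⟨h, -⟩ | ⟨h, -⟩
    · rw [h]; omega
    · omega

theorem chain_injective (hx : c x = 1) (hy : c y = 1) (k : ℕ)
    (heq : chain c pred x k = chain c pred y k) : x = y := by
  induction k with
  | zero => exact heq
  | succ k ih =>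
    apply ih
    have h₁ := colorTime_chain (pred := pred) hx k
    have h₂ := colorTime_chain (pred := pred) hy k
    rcases chain_succ c pred x k with ⟨e₁, -⟩ | ⟨e₁, e₁'⟩ <;>
      rcases chain_succ c pred y k with ⟨e₂, -⟩ | ⟨e₂, e₂'⟩
    · rw [← e₁, heq, e₂]
    · rw [heq] at e₁; rw [e₁] at e₂; omega
    · rw [← heq] at e₂; rw [e₂] at e₁; omega
    · rw [← e₁', heq, e₂']

theorem colorTime_chain_mono (hx : c x = 1) : Monotone fun k => c (chain c pred x k) := by
  refine monotone_nat_of_le_succ fun k => ?_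
  have := colorTime_chain (pred := pred) hx k
  rcases chain_succ c pred x k with ⟨h, -⟩ | ⟨h, -⟩
  · rw [h]
  · omega

/-- The first change of a chain after time `k` and before time `l`. -/
theorem chain_eq_or_exists (c : V → ℕ) (pred : V → V) (x : V) {k l : ℕ} (hkl : k ≤ l) :
    chain c pred x l = chain c pred x k ∨ ∃ m, k ≤ m ∧ m < l ∧
      chain c pred x m = chain c pred x k ∧ c (chain c pred x (m + 1)) = m + 2 ∧
        pred (chain c pred x (m + 1)) = chain c pred x k := by
  induction l, hkl using Nat.le_induction with
  | base => exact Or.inl rfl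
  | succ l hl ih =>
    rcases ih with ih | ⟨m, h₁, h₂, h₃⟩
    · rcases chain_succ c pred x l with ⟨h, -⟩ | ⟨h, h'⟩
      · exact Or.inl (h.trans ih)
      · exact Or.inr ⟨l, hl, l.lt_succ_self, ih, h, h'.trans ih⟩
    · exact Or.inr ⟨m, h₁, by omega, h₃⟩

/-- A vertex occurs in one chain only, and there on an interval of timesteps. -/
theorem chain_eq_chain (hx : c x = 1) (hy : c y = 1) {k l : ℕ} (hkl : k ≤ l)
    (heq : chain c pred x k = chain c pred y l) :
    x = y ∧ ∀ m, k ≤ m → m ≤ l → chain c pred y m = chain c pred y k := by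
  have hconst : ∀ m, k ≤ m → m ≤ l → chain c pred y m = chain c pred y k := by
    intro m hkm hml
    rcases chain_eq_or_exists c pred y hkm with h | ⟨j, h₁, h₂, -, h₃, -⟩
    · exact h
    · have h₄ : c (chain c pred y (j + 1)) ≤ c (chain c pred y l) :=
        colorTime_chain_mono hy (by omega)
      have h₅ := (colorTime_chain (pred := pred) hx k).2
      rw [heq] at h₅
      omega
  exact ⟨chain_injective hx hy k (heq.trans (hconst l hkl le_rfl)), hconst⟩

/-- A neighbor that becomes colored later than a vertex `u` of a chain either becomes colored while
`u` still is responsible for forcing, or it is the vertex forced by `u`. -/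
theorem chain_eq_or_forced (h : IsSchedule G c pred) {k : ℕ} {w : V}
    (hadj : G.Adj (chain c pred x k) w) (hk : k + 1 ≤ c w) :
    chain c pred x (c w - 1) = chain c pred x k ∨ ∃ m, m + 1 < c w ∧
      chain c pred x m = chain c pred x k ∧ chain c pred x (m + 1) = w := by
  rcases chain_eq_or_exists c pred x (k := k) (l := c w - 1) (by omega) with
    h' | ⟨m, h₁, h₂, h₃, h₄, h₅⟩
  · exact Or.inl h'
  · refine Or.inr ⟨m, by omega, h₃, (h.eq_of_pred_adj _ w (by omega) ?_ (by omega)).symm⟩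
    rwa [h₅]

/-- The chains cover all vertices outside the initial set: when `v` becomes colored, the vertex
forcing it still is the current one of its chain, so that `v` becomes the next one. -/
theorem exists_chain_eq (h : IsSchedule G c pred) (v : V) (hv : 1 ≤ c v) :
    ∃ x, c x = 1 ∧ chain c pred x (c v - 1) = v := by
  induction hn : c v using Nat.strong_induction_on generalizing v with
  | _ n ih =>
    subst hn
    rcases hv.eq_or_lt with hv | hv
    · exact ⟨v, hv.symm, by rw [← hv]; rfl⟩
    · have hlt := h.pred_lt v hv
      have h1 : 1 ≤ c (pred v) := by
        by_contra h0
        have := h.le_one (pred v) v (by omega) (h.pred_adj v hv)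
        omega
      obtain ⟨x, hx, hxe⟩ := ih _ hlt (pred v) h1 rfl
      refine ⟨x, hx, ?_⟩
      obtain ⟨k, hk⟩ := Nat.exists_eq_add_of_le' (show 2 ≤ c v from hv)
      have e : c v - 1 = k + 1 := by omega
      rcases chain_eq_or_exists c pred x (k := c (pred v) - 1) (l := k) (by omega) with
        h' | ⟨m, h₁, h₂, h₃, h₄, h₅⟩
      · rw [e]
        exact h.chain_succ_of_pred hk (hxe.symm.trans h'.symm)
      · have := h.eq_of_pred_eq (v := chain c pred x (m + 1)) (w := v) (by omega) (by omega)
          (h₅.trans hxe)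
        rw [this] at hk
        omega

end IsSchedule

open IsSchedule in
/-- The chains are the paths of `𝒢(s, a, b)`, in which the edges along constant stretches are
contracted, and `K_s` is the initial set. Complete and cross edges are deleted if they do not map to
edges of `G`. -/
theorem isObtainable_of_isSchedule [Fintype V] {c : V → ℕ} {pred : V → V}
    (h : IsSchedule G c pred) {b : ℕ} (hb : ∀ v, c v ≤ b) (S : Finset V)
    (hS : ∀ v, v ∈ S ↔ c v = 0) : ∃ a, IsObtainable G S.card a b := by
  classical
  let A : Finset V := {v | c v = 1}
  have hA : ∀ x : Fin A.card, c (A.equivFin.symm x) = 1 := fun x =>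
    (Finset.mem_filter.1 (A.equivFin.symm x).2).2
  let f : BigVertex S.card A.card b → V :=
    Sum.elim (fun i => S.equivFin.symm i) fun p => chain c pred (A.equivFin.symm p.1) p.2
  have hfl : ∀ i, c (f (Sum.inl i)) = 0 := fun i => (hS _).1 (S.equivFin.symm i).2
  have hfr : ∀ x k, f (Sum.inr (x, k)) = chain c pred (A.equivFin.symm x) k := fun _ _ => rfl
  have hfr1 : ∀ p, 1 ≤ c (f (Sum.inr p)) := fun p => (colorTime_chain (hA p.1) p.2).1
  have hsl : ∀ v, c v = 0 → ∃ i, f (Sum.inl i) = v := fun v hv =>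
    ⟨S.equivFin ⟨v, (hS v).2 hv⟩, by simp [f]⟩
  have hsr : ∀ v, 1 ≤ c v → ∃ x k, k.val = c v - 1 ∧ f (Sum.inr (x, k)) = v := fun v hv => by
    obtain ⟨x, hx, hxe⟩ := h.exists_chain_eq v hv
    refine ⟨A.equivFin ⟨x, by simpa [A] using hx⟩, ⟨c v - 1, ?_⟩, rfl, ?_⟩
    · have := hb v
      omega
    · simpa [f] using hxe
  have hinj : ∀ x y, (A.equivFin.symm x : V) = A.equivFin.symm y → x = y := fun x y hxy =>
    A.equivFin.symm.injective (Subtype.ext hxy)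
  let P : Set (Sym2 (BigVertex S.card A.card b)) := {e ∈ pathEdges _ _ _ | (e.map f).IsDiag}
  let K : Set (Sym2 (BigVertex S.card A.card b)) :=
    {e ∈ completeEdges _ _ _ | e.map f ∉ G.edgeSet}
  let C : Set (Sym2 (BigVertex S.card A.card b)) :=
    {e ∈ crossEdges _ _ _ | e.map f ∉ G.edgeSet}
  refine ⟨A.card, P, fun e he => he.1, K, fun e he => he.1, C, fun e he => he.1, ?_,
    (nonempty_iso_contractEdges_iff _ _ _).2 ⟨f, ?_, ?_, ?_⟩⟩
  · rintro v ⟨⟨⟨x, k⟩, rfl⟩, e, he, hv⟩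
    obtain ⟨i, x', k', hk, rfl⟩ := he
    obtain ⟨rfl, rfl⟩ : x = x' ∧ k = k' := by simpa using hv
    have hx : f (Sum.inr (x, k)) = A.equivFin.symm x := by rw [hfr, hk]; rfl
    obtain ⟨u, hu, huv⟩ := h.exists_adj _ (hA x)
    obtain ⟨j, rfl⟩ := hsl u hu
    have he : s(Sum.inl j, Sum.inr (x, k)) ∈ crossEdges S.card A.card b := ⟨j, x, k, hk, rfl⟩
    refine ⟨_, ⟨he, fun hC => hC.2 ?_⟩, by simp⟩
    rw [Sym2.map_mk, SimpleGraph.mem_edgeSet, hx]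
    exact huv
  · intro v
    rcases Nat.eq_zero_or_pos (c v) with hv | hv
    · exact (hsl v hv).imp' Sum.inl fun _ => id
    · obtain ⟨x, k, -, hxk⟩ := hsr v hv
      exact ⟨_, hxk⟩
  · have hreach : ∀ x (k l : Fin b), k ≤ l → (∀ m, k.val ≤ m → m ≤ l.val →
        chain c pred (A.equivFin.symm x) m = chain c pred (A.equivFin.symm x) k) →
        (SimpleGraph.fromEdgeSet P).Reachable (Sum.inr (x, k)) (Sum.inr (x, l)) := by
      rintro x k ⟨l, hl⟩ hkl hc
      induction l, (show k.val ≤ l from hkl) using Nat.le_induction with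
      | base => exact SimpleGraph.Reachable.refl _
      | succ l hkl' ih =>
        refine (ih (by omega) hkl' fun m h₁ h₂ => hc m h₁ (Nat.le_succ_of_le h₂)).trans
          (SimpleGraph.Adj.reachable ⟨⟨mem_pathEdges_mk.2 ⟨x, _, _, rfl, rfl, Or.inl rfl⟩, ?_⟩, ?_⟩)
        · rw [Sym2.map_mk, Sym2.mk_isDiag_iff]
          exact (hc l hkl' (Nat.le_succ l)).trans (hc (l + 1) (by omega) le_rfl).symm
        · simp
    intro w w'
    constructor
    · intro hw
      rcases w with i | ⟨x, k⟩ <;> rcases w' with j | ⟨y, l⟩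
      · have : i = j := S.equivFin.symm.injective (Subtype.ext hw)
        rw [this]
      · have h₁ := hfl i
        have h₂ := hfr1 (y, l)
        rw [← hw] at h₂
        omega
      · have h₁ := hfl j
        have h₂ := hfr1 (x, k)
        rw [hw] at h₂
        omega
      · rcases le_total k l with hkl | hkl
        · obtain ⟨he, hc⟩ := chain_eq_chain (hA x) (hA y) hkl hw
          obtain rfl := hinj _ _ he
          exact hreach x k l hkl hc
        · obtain ⟨he, hc⟩ := chain_eq_chain (hA y) (hA x) hkl hw.symm
          obtain rfl := hinj _ _ he
          exact (hreach y l k hkl hc).symm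
    · intro hw
      refine (mem_of_reachable (A := {w' | f w' = f w}) ?_ hw rfl).symm
      intro u v huv hu
      have := huv.1.2
      rw [Sym2.map_mk, Sym2.mk_isDiag_iff] at this
      exact this.symm.trans hu
  · intro u v
    constructor
    · intro huv
      refine ⟨huv.ne, ?_⟩
      -- when `v` becomes colored, `u` still is on its chain, or its successor is `v`
      wlog hle : c u ≤ c v generalizing u v
      · obtain ⟨w, w', h₁, h₂, h₃⟩ := this v u huv.symm (le_of_not_ge hle)
        exact ⟨w', w, h₂, h₁, h₃.symm⟩
      have hcomplete : ∀ p q, f p = u → f q = v → s(p, q) ∈ completeEdges S.card A.card b →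
          ((bigGraph S.card A.card b).deleteEdges (K ∪ C)).Adj p q := by
        rintro p q rfl rfl hpq
        refine bigGraph_deleteEdges_adj.2 ⟨Or.inr (Or.inl hpq), fun h' => huv.ne (h' ▸ rfl), ?_⟩
        rintro (h' | h')
        · exact h'.2 huv
        · exact h'.2 huv
      have hcross : ∀ p q, f p = u → f q = v → s(p, q) ∈ crossEdges S.card A.card b →
          ((bigGraph S.card A.card b).deleteEdges (K ∪ C)).Adj p q := by
        rintro p q rfl rfl hpq
        refine bigGraph_deleteEdges_adj.2 ⟨Or.inr (Or.inr hpq), fun h' => huv.ne (h' ▸ rfl), ?_⟩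
        rintro (h' | h')
        · exact h'.2 huv
        · exact h'.2 huv
      rcases Nat.eq_zero_or_pos (c u) with hu | hu
      · obtain ⟨i, hi⟩ := hsl u hu
        rcases Nat.eq_zero_or_pos (c v) with hv | hv
        · obtain ⟨j, hj⟩ := hsl v hv
          refine ⟨_, _, hi, hj, hcomplete _ _ hi hj (mem_completeEdges_mk.2 (Or.inl
            ⟨i, j, fun hij => huv.ne ?_, rfl, rfl⟩))⟩
          rw [← hi, ← hj, hij]
        · obtain ⟨x, k, hk, hxk⟩ := hsr v hv
          have := h.le_one u v hu huv
          exact ⟨_, _, hi, hxk, hcross _ _ hi hxk ⟨i, x, k, by omega, rfl⟩⟩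
      · obtain ⟨x, k, hk, hxk⟩ := hsr u hu
        obtain ⟨y, l, hl, hyl⟩ := hsr v (hu.trans_le hle)
        rw [hfr] at hxk
        rcases h.chain_eq_or_forced (x := (A.equivFin.symm x : V)) (k := k) (w := v)
          (by rwa [hxk]) (by omega) with h' | ⟨m, hm, h₁, h₂⟩
        · have hxl : f (Sum.inr (x, l)) = u := by rw [hfr, hl, h', hxk]
          refine ⟨_, _, hxl, hyl, hcomplete _ _ hxl hyl (mem_completeEdges_mk.2 (Or.inr
            ⟨x, y, l, fun hxy => huv.ne ?_, rfl, rfl⟩))⟩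
          rw [← hxl, ← hyl, hxy]
        · have hb' := hb v
          have hpath : s(Sum.inr (x, ⟨m, by omega⟩), Sum.inr (x, ⟨m + 1, by omega⟩)) ∈
            pathEdges S.card A.card b := mem_pathEdges_mk.2 ⟨x, _, _, rfl, rfl, Or.inl rfl⟩
          exact ⟨Sum.inr (x, ⟨m, _⟩), Sum.inr (x, ⟨m + 1, _⟩), h₁.trans hxk, h₂,
            bigGraph_deleteEdges_adj.2 ⟨Or.inl hpath, by simp,
              pathEdges_disjoint_delete (fun e he => he.1) (fun e he => he.1) hpath⟩⟩
    · rintro ⟨hne, p, q, rfl, rfl, hpq⟩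
      obtain ⟨h₁, -, h₂⟩ := bigGraph_deleteEdges_adj.1 hpq
      rcases h₁ with h₁ | h₁ | h₁
      · obtain ⟨x, k, l, rfl, rfl, h₃⟩ := mem_pathEdges_mk.1 h₁
        have hstep : ∀ k l : Fin b, k.val + 1 = l.val →
            f (Sum.inr (x, k)) ≠ f (Sum.inr (x, l)) →
            G.Adj (f (Sum.inr (x, k))) (f (Sum.inr (x, l))) := by
          intro k l hkl hne
          rw [hfr, hfr, ← hkl] at hne ⊢
          rcases chain_succ c pred (A.equivFin.symm x) k with ⟨h', -⟩ | ⟨h', h''⟩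
          · exact absurd h'.symm hne
          · exact h'' ▸ h.pred_adj _ (by omega)
        rcases h₃ with h₃ | h₃
        · exact hstep _ _ h₃ hne
        · exact (hstep _ _ h₃ hne.symm).symm
      · by_contra hG
        exact h₂ (Or.inl ⟨h₁, hG⟩)
      · by_contra hG
        exact h₂ (Or.inr ⟨h₁, hG⟩)

theorem throttlingNumber_le_iff_structuralCondition [Fintype V] [Nonempty V] (t : ℕ) :
    throttlingNumber G ≤ t ↔ StructuralCondition t G := by
  rw [throttlingNumber_le_iff]
  constructor
  · rintro ⟨S, hS, hc⟩
    obtain ⟨pred, hpred⟩ := exists_isSchedule hc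
    obtain ⟨a, ha⟩ := isObtainable_of_isSchedule hpred (b := t - S.card)
      (fun v => (mem_colored_iff hc v _).1 (hc ▸ Set.mem_univ v)) S
      (fun v => (mem_colored_iff hc v 0).trans Nat.le_zero)
    refine ⟨S.card, a, t - S.card, Nat.pos_of_ne_zero fun h => ?_, by omega, ha⟩
    rw [Finset.card_eq_zero] at h
    subst h
    rw [Finset.coe_empty, colored_empty] at hc
    exact Set.empty_ne_univ hc
  · rintro ⟨s, a, b, hs, rfl, h⟩
    obtain ⟨S, hS, hc⟩ := h.exists_colored_eq_univ hs
    exact ⟨S, by omega, Set.eq_univ_of_univ_subset (hc ▸ colored_mono G _ (by omega))⟩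

end ForcingChains

/-! ### Structured stack programs and their compilation to Turing machines -/

/-- Structured programs working on stacks with symbols in `A`, indexed by `J`, and on a register
with values in `σ`. -/
inductive Prog (J A σ : Type) : Type
  | push (k : J) (g : σ → A)
  | pop (k : J) (h : σ → Option A → σ)
  | load (f : σ → σ)
  | seq (p q : Prog J A σ)
  | ite (c : σ → Bool) (p q : Prog J A σ)
  | loop (c : σ → Bool) (p : Prog J A σ)

namespace Prog

variable {J A σ : Type}

/-- `Run p v S n v' S'`: started with register `v` and stacks `S`, the program `p` ends after
exactly `n` steps with register `v'` and stacks `S'`. -/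
inductive Run [DecidableEq J] : Prog J A σ → σ → (J → List A) → ℕ → σ → (J → List A) → Prop
  | push (k g v S) : Run (.push k g) v S 1 v (Function.update S k (g v :: S k))
  | pop (k h v S) :
      Run (.pop k h) v S 1 (h v (S k).head?) (Function.update S k (S k).tail)
  | load (f v S) : Run (.load f) v S 1 (f v) S
  | seq {p q v S m v' S' n v'' S''} : Run p v S m v' S' → Run q v' S' n v'' S'' →
      Run (.seq p q) v S (m + n) v'' S''
  | ite_true {c p v S n v' S'} (q) : c v = true → Run p v S n v' S' →
      Run (.ite c p q) v S (1 + n) v' S'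
  | ite_false {c q v S n v' S'} (p) : c v = false → Run q v S n v' S' →
      Run (.ite c p q) v S (1 + n) v' S'
  | loop_false {c v} (p S) : c v = false → Run (.loop c p) v S 1 v S
  | loop_true {c p v S m v' S' n v'' S''} : c v = true → Run p v S m v' S' →
      Run (.loop c p) v' S' n v'' S'' → Run (.loop c p) v S (1 + m + n) v'' S''

/-- The labels needed in order to compile a program, one for each node of its syntax tree other
than sequential compositions. -/
def Label : Prog J A σ → Type
  | push _ _ => Unit
  | pop _ _ => Unit
  | load _ => Unit
  | seq p q => Label p ⊕ Label q
  | ite _ p q => Option (Label p ⊕ Label q)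
  | loop _ p => Option (Label p)

noncomputable instance fintypeLabel : (p : Prog J A σ) → Fintype (Label p)
  | push _ _ => inferInstanceAs (Fintype Unit)
  | pop _ _ => inferInstanceAs (Fintype Unit)
  | load _ => inferInstanceAs (Fintype Unit)
  | seq p q =>
    letI := fintypeLabel p; letI := fintypeLabel q
    inferInstanceAs (Fintype (Label p ⊕ Label q))
  | ite _ p q =>
    letI := fintypeLabel p; letI := fintypeLabel q
    inferInstanceAs (Fintype (Option (Label p ⊕ Label q)))
  | loop _ p =>
    letI := fintypeLabel p
    inferInstanceAs (Fintype (Option (Label p)))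

/-- The label at which the compiled program starts. -/
def entry : (p : Prog J A σ) → Label p
  | push _ _ => ()
  | pop _ _ => ()
  | load _ => ()
  | seq p _ => Sum.inl (entry p)
  | ite _ _ _ => (none : Option _)
  | loop _ _ => (none : Option _)

/-- The alphabets of the stacks of the compiled program: a further stack `none` for the output is
added to those of the program. -/
abbrev StackAlphabet (J A : Type) : Option J → Type
  | none => Bool
  | some _ => A

open Turing in
/-- The compiled program, with labels placed by `emb` among the labels of a larger machine, which
jumps to `exit` when it is done. -/
def compile {Λ : Type} : (p : Prog J A σ) → (Label p → Λ) → Λ → Label p →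
    TM2.Stmt (StackAlphabet J A) Λ σ
  | push k g, _, exit, _ => .push (some k) g (.goto fun _ => exit)
  | pop k h, _, exit, _ => .pop (some k) h (.goto fun _ => exit)
  | load f, _, exit, _ => .load f (.goto fun _ => exit)
  | seq p q, emb, exit, l => l.elim
      (compile p (fun l => emb (Sum.inl l)) (emb (Sum.inr (entry q))))
      (compile q (fun l => emb (Sum.inr l)) exit)
  | ite c p q, emb, exit, l => Option.elim l
      (.branch c (.goto fun _ => emb (some (Sum.inl (entry p))))
        (.goto fun _ => emb (some (Sum.inr (entry q)))))
      (Sum.elim (compile p (fun l => emb (some (Sum.inl l))) exit)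
        (compile q (fun l => emb (some (Sum.inr l))) exit))
  | loop c p, emb, exit, l => Option.elim l
      (.branch c (.goto fun _ => emb (some (entry p))) (.goto fun _ => exit))
      (compile p (fun l => emb (some l)) (emb none))

/-- The stacks of the machine, when the output stack is empty. -/
def machineStacks (S : J → List A) : ∀ k, List (StackAlphabet J A k)
  | none => []
  | some j => S j

section

variable [DecidableEq J]

theorem update_machineStacks (S : J → List A) (k : J) (l : List A) :
    Function.update (machineStacks S) (some k) l = machineStacks (Function.update S k l) := by
  funext j
  cases j with
  | none => rfl
  | some j =>
    by_cases h : j = k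
    · subst h; simp [machineStacks]
    · simp [machineStacks, h]

variable {Λ : Type}

open Turing

/-- `c'` is reached from `c` in exactly `n` steps. -/
def StepsTo (M : Λ → TM2.Stmt (StackAlphabet J A) Λ σ) (n : ℕ)
    (c c' : TM2.Cfg (StackAlphabet J A) Λ σ) : Prop :=
  (flip bind (TM2.step M))^[n] (some c) = some c'

theorem StepsTo.trans {M : Λ → TM2.Stmt (StackAlphabet J A) Λ σ} {m n : ℕ}
    {c₁ c₂ c₃ : TM2.Cfg (StackAlphabet J A) Λ σ} (h₁ : StepsTo M m c₁ c₂)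
    (h₂ : StepsTo M n c₂ c₃) : StepsTo M (m + n) c₁ c₃ := by
  unfold StepsTo at *
  rw [Nat.add_comm, Function.iterate_add_apply, h₁, h₂]

/-- The compiled program simulates the program step by step. -/
theorem Run.stepsTo {p : Prog J A σ} {v v' : σ} {S S' : J → List A} {n : ℕ}
    (h : Run p v S n v' S') (M : Λ → TM2.Stmt (StackAlphabet J A) Λ σ) (emb : Label p → Λ)
    (exit : Λ) (hM : ∀ l, M (emb l) = compile p emb exit l) :
    StepsTo M n ⟨some (emb p.entry), v, machineStacks S⟩ ⟨some exit, v', machineStacks S'⟩ := by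
  have single : ∀ {l : Λ} {v : σ} {S} {c}, TM2.stepAux (M l) v S = c →
      StepsTo M 1 ⟨some l, v, S⟩ c := fun h => congrArg some h
  induction h generalizing exit with
  | push k g v S =>
    apply single
    rw [hM]
    simp only [compile, TM2.stepAux, update_machineStacks]
    rfl
  | pop k g v S =>
    apply single
    rw [hM]
    simp only [compile, TM2.stepAux, update_machineStacks]
    rfl
  | load f v S =>
    apply single
    rw [hM]
    rfl
  | @seq p q _ _ _ _ _ _ _ _ _ _ ih₁ ih₂ =>
    exact (ih₁ (fun l => emb (Sum.inl l)) (emb (Sum.inr q.entry)) fun l => hM (Sum.inl l)).trans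
      (ih₂ (fun l => emb (Sum.inr l)) exit fun l => hM (Sum.inr l))
  | ite_true q hc _ ih =>
    refine (single ?_).trans (ih (fun l => emb (some (Sum.inl l))) exit
      fun l => hM (some (Sum.inl l)))
    rw [hM]
    simp [compile, entry, TM2.stepAux, hc]
  | ite_false p hc _ ih =>
    refine (single ?_).trans (ih (fun l => emb (some (Sum.inr l))) exit
      fun l => hM (some (Sum.inr l)))
    rw [hM]
    simp [compile, entry, TM2.stepAux, hc]
  | loop_false p S hc =>
    apply single
    rw [hM]
    simp [compile, entry, TM2.stepAux, hc]
  | loop_true hc _ _ ih₁ ih₂ =>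
    refine ((single ?_).trans (ih₁ (fun l => emb (some l)) (emb none) fun l => hM (some l))).trans
      (ih₂ emb exit hM)
    rw [hM]
    simp [compile, entry, TM2.stepAux, hc]

/-- The machine that runs the program `p` with input on the stack `k`, and then outputs the
bit `out v` of the final register `v`. -/
noncomputable def machine [Fintype J] [Fintype A] [Fintype σ] (p : Prog J A σ) (k : J)
    (v₀ : σ) (out : σ → Bool) : FinTM2 where
  K := Option J
  kDecidableEq := inferInstance
  k₀ := some k
  k₁ := none
  Γ := StackAlphabet J A
  Λ := Option (Label p)
  main := some p.entry
  σ := σ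
  initialState := v₀
  Γk₀Fin := inferInstanceAs (Fintype A)
  m
    | none => .push none out (.load (fun _ => v₀) .halt)
    | some l => compile p some none l

/-- A program that decides `f` in polynomially many steps, leaving all stacks empty, yields a Turing
machine that does so. -/
theorem nonempty_computableInPolyTime [Fintype J] [Fintype A] [Fintype σ] (p : Prog J A σ)
    (k : J) (v₀ : σ) (out : σ → Bool) {α : Type} (enc : α → List A) (f : α → Bool)
    (P : Polynomial ℕ)
    (h : ∀ a, ∃ n v, n ≤ P.eval (enc a).length ∧ out v = f a ∧
      Run p v₀ (Function.update (fun _ => []) k (enc a)) n v fun _ => []) :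
    Nonempty (TM2ComputableInPolyTime enc Computability.encodeBool f) := by
  choose n v hn hv hrun using h
  refine ⟨{ tm := machine p k v₀ out
            inputAlphabet := Equiv.refl A
            outputAlphabet := Equiv.refl Bool
            time := P + 1
            outputsFun := fun a => ⟨⟨n a + 1, ?_⟩, ?_⟩ }⟩
  · have h₁ := (hrun a).stepsTo (machine p k v₀ out).m some none fun _ => rfl
    have h₂ : StepsTo (machine p k v₀ out).m 1 ⟨some none, v a, machineStacks fun _ => []⟩
        (haltList (machine p k v₀ out) [f a]) := by
      refine congrArg some ?_
      rw [← hv]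
      simp only [haltList]
      refine (TM2.Cfg.mk.injEq ..).mpr ⟨rfl, rfl, funext fun j => ?_⟩
      cases j with
      | none => rfl
      | some j => rfl
    have h₃ : initList (machine p k v₀ out) (List.map (Equiv.refl A).invFun (enc a)) =
      ⟨some (some p.entry), v₀, machineStacks (Function.update (fun _ => []) k (enc a))⟩ := by
      simp only [initList]
      refine (TM2.Cfg.mk.injEq ..).mpr ⟨rfl, rfl, funext fun j => ?_⟩
      cases j with
      | none => rfl
      | some j =>
        by_cases hj : j = k
        · subst hj
          simp [machine, machineStacks]
          rfl
        · have : ¬ some j = (machine p k v₀ out).k₀ := fun h => hj (Option.some.inj h)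
          rw [machineStacks, Function.update_of_ne hj]
          exact dif_neg this
    rw [h₃]
    exact h₁.trans h₂
  · simpa using hn a

end

end Prog

/-! ### Running times of programs, and counters in unary -/

namespace Prog

variable {J A σ : Type} [DecidableEq J]

/-- `RunWithin p v S N v' S'`: started with register `v` and stacks `S`, the program `p` ends after
at most `N` steps with register `v'` and stacks `S'`. -/
def RunWithin (p : Prog J A σ) (v : σ) (S : J → List A) (N : ℕ) (v' : σ) (S' : J → List A) : Prop :=
  ∃ n ≤ N, Run p v S n v' S'

namespace RunWithin

theorem mono {p : Prog J A σ} {v v' : σ} {S S' : J → List A} {M N : ℕ}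
    (h : RunWithin p v S M v' S') (hMN : M ≤ N) : RunWithin p v S N v' S' :=
  let ⟨n, hn, hr⟩ := h
  ⟨n, hn.trans hMN, hr⟩

theorem congr {p : Prog J A σ} {v v' : σ} {S S' S'' : J → List A} {M N : ℕ}
    (h : RunWithin p v S M v' S') (hMN : M ≤ N) (hS : S' = S'') : RunWithin p v S N v' S'' :=
  hS ▸ h.mono hMN

theorem seq {p q : Prog J A σ} {v v' v'' : σ} {S S' S'' : J → List A} {M N : ℕ}
    (h₁ : RunWithin p v S M v' S') (h₂ : RunWithin q v' S' N v'' S'') :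
    RunWithin (p.seq q) v S (M + N) v'' S'' :=
  let ⟨_, hm, h₁⟩ := h₁
  let ⟨_, hn, h₂⟩ := h₂
  ⟨_, add_le_add hm hn, h₁.seq h₂⟩

theorem push (k : J) (g : σ → A) (v : σ) (S : J → List A) :
    RunWithin (.push k g) v S 1 v (Function.update S k (g v :: S k)) :=
  ⟨1, le_rfl, .push k g v S⟩

theorem pop (k : J) (h : σ → Option A → σ) (v : σ) (S : J → List A) :
    RunWithin (.pop k h) v S 1 (h v (S k).head?) (Function.update S k (S k).tail) :=
  ⟨1, le_rfl, .pop k h v S⟩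

theorem load (f : σ → σ) (v : σ) (S : J → List A) : RunWithin (.load f) v S 1 (f v) S :=
  ⟨1, le_rfl, .load f v S⟩

theorem ite_true {c : σ → Bool} {p : Prog J A σ} {v v' : σ} {S S' : J → List A} {N : ℕ}
    (q : Prog J A σ) (hc : c v = true) (h : RunWithin p v S N v' S') :
    RunWithin (.ite c p q) v S (1 + N) v' S' :=
  let ⟨_, hn, h⟩ := h
  ⟨_, Nat.add_le_add_left hn 1, .ite_true q hc h⟩

theorem ite_false {c : σ → Bool} {q : Prog J A σ} {v v' : σ} {S S' : J → List A} {N : ℕ}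
    (p : Prog J A σ) (hc : c v = false) (h : RunWithin q v S N v' S') :
    RunWithin (.ite c p q) v S (1 + N) v' S' :=
  let ⟨_, hn, h⟩ := h
  ⟨_, Nat.add_le_add_left hn 1, .ite_false p hc h⟩

theorem loop_false {c : σ → Bool} {v : σ} (p : Prog J A σ) (S : J → List A) (hc : c v = false) :
    RunWithin (.loop c p) v S 1 v S :=
  ⟨1, le_rfl, .loop_false p S hc⟩

theorem loop_true {c : σ → Bool} {p : Prog J A σ} {v v' v'' : σ} {S S' S'' : J → List A}
    {M N : ℕ} (hc : c v = true) (h₁ : RunWithin p v S M v' S')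
    (h₂ : RunWithin (.loop c p) v' S' N v'' S'') :
    RunWithin (.loop c p) v S (1 + M + N) v'' S'' :=
  let ⟨_, hm, h₁⟩ := h₁
  let ⟨_, hn, h₂⟩ := h₂
  ⟨_, add_le_add (Nat.add_le_add_left hm 1) hn, .loop_true hc h₁ h₂⟩

end RunWithin

/-- The symbols on the stacks: those of the encoding of graphs. -/
abbrev Symbol : Type := Option Bool

/-- The register: a truth value, and the symbol that was popped last. -/
abbrev Register : Type := Bool × Option Symbol

/-- The symbol used to write numbers in unary. -/
abbrev tick : Symbol := some true

/-- The number `n` in unary. -/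
abbrev unary (n : ℕ) : List Symbol := List.replicate n tick

/-- Pop a symbol into the register. -/
def fetch (k : J) : Prog J Symbol Register := .pop k fun v a => (v.1, a)

/-- Push the symbol in the register. -/
def store (k : J) : Prog J Symbol Register := .push k fun v => v.2.getD none

/-- Push a tick. -/
def count (k : J) : Prog J Symbol Register := .push k fun _ => tick

/-- Set the truth value in the register. -/
def setBit (b : Bool) : Prog J Symbol Register := .load fun v => (b, v.2)

/-- Forget the symbol in the register. -/
def forget : Prog J Symbol Register := .load fun v => (v.1, none)

/-- Run `body` for each symbol popped from the stack `k`, until that stack is empty. -/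
def forEach (k : J) (body : Prog J Symbol Register) : Prog J Symbol Register :=
  (fetch k).seq (.loop (fun v => v.2.isSome) (body.seq (fetch k)))

/-- Move the content of a stack, in reverse order, onto another one. -/
def move (k l : J) : Prog J Symbol Register := forEach k (store l)

/-- Empty a stack. -/
def clear (k : J) : Prog J Symbol Register := forEach k forget

/-- Copy a number in unary from `k` to `l`, with the help of the stack `m`. -/
def copy (k l m : J) : Prog J Symbol Register :=
  (forEach k ((count l).seq (count m))).seq (move m k)

variable {b b' : Bool} {r r' : Option Symbol} {S S' S'' : J → List Symbol} {M N : ℕ}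

theorem runWithin_fetch (k : J) (b : Bool) (r : Option Symbol) (S : J → List Symbol) :
    RunWithin (fetch k) (b, r) S 1 (b, (S k).head?) (Function.update S k (S k).tail) :=
  .pop ..

theorem runWithin_store (k : J) (b : Bool) (a : Symbol) (S : J → List Symbol) :
    RunWithin (store k) (b, some a) S 1 (b, some a) (Function.update S k (a :: S k)) :=
  .push ..

theorem runWithin_count (k : J) (v : Register) (S : J → List Symbol) :
    RunWithin (count k) v S 1 v (Function.update S k (tick :: S k)) :=
  .push ..

theorem runWithin_setBit (b' b : Bool) (r : Option Symbol) (S : J → List Symbol) :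
    RunWithin (setBit b') (b, r) S 1 (b', r) S :=
  .load ..

theorem runWithin_forget (b : Bool) (r : Option Symbol) (S : J → List Symbol) :
    RunWithin (forget : Prog J Symbol Register) (b, r) S 1 (b, none) S :=
  .load ..

theorem runWithin_forEach_nil {k : J} (body : Prog J Symbol Register) (hk : S k = [])
    (b : Bool) (r : Option Symbol) : RunWithin (forEach k body) (b, r) S 2 (b, none) S := by
  have h := runWithin_fetch k b r S
  rw [hk, List.tail_nil, List.head?_nil, ← hk, Function.update_eq_self] at h
  exact h.seq (.loop_false _ _ rfl)

theorem runWithin_forEach_cons {k : J} {body : Prog J Symbol Register} {a : Symbol}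
    {l : List Symbol} (hk : S k = a :: l) {v : Register}
    (hbody : RunWithin body (b, some a) (Function.update S k l) M (b', r') S')
    (hrest : RunWithin (forEach k body) (b', r') S' N v S'') (r : Option Symbol) :
    RunWithin (forEach k body) (b, r) S (M + N + 2) v S'' := by
  have h := runWithin_fetch k b r S
  rw [hk, List.tail_cons, List.head?_cons] at h
  obtain ⟨m, hm, hbody⟩ := hbody
  obtain ⟨n, hn, hrest⟩ := hrest
  obtain ⟨i, hi, h⟩ := h
  cases hrest with
  | @seq _ _ _ _ j _ _ n' _ _ h₁ h₂ =>
    exact ⟨i + (1 + (m + j) + n'), by omega, h.seq (.loop_true rfl (hbody.seq h₁) h₂)⟩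

theorem runWithin_move {k l : J} (hkl : k ≠ l) (b : Bool) (r : Option Symbol)
    (S : J → List Symbol) :
    RunWithin (move k l) (b, r) S (3 * (S k).length + 2) (b, none)
      (Function.update (Function.update S k []) l ((S k).reverse ++ S l)) := by
  induction hc : S k generalizing S r with
  | nil =>
    rw [← hc, Function.update_eq_self, hc, List.reverse_nil, List.nil_append,
      Function.update_eq_self]
    exact runWithin_forEach_nil _ hc b r
  | cons a t ih =>
    have h₁ := runWithin_store l b a (Function.update S k t)
    have h₂ := ih (some a) (Function.update (Function.update S k t) l
      (a :: (Function.update S k t) l)) (by simp [hkl])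
    refine (runWithin_forEach_cons hc h₁ h₂ r).congr (by simp; omega) ?_
    funext j
    by_cases hj : j = l
    · subst hj; simp [hkl.symm]
    · by_cases hj' : j = k
      · subst hj'; simp [hj]
      · simp [hj, hj']

theorem runWithin_clear (k : J) (b : Bool) (r : Option Symbol) (S : J → List Symbol) :
    RunWithin (clear k) (b, r) S (3 * (S k).length + 2) (b, none) (Function.update S k []) := by
  induction hc : S k generalizing S r with
  | nil =>
    rw [← hc, Function.update_eq_self]
    exact (runWithin_forEach_nil _ hc b r).mono (by omega)
  | cons a t ih =>
    have h₁ := runWithin_forget b (some a) (Function.update S k t)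
    have h₂ := ih none (Function.update S k t) (by simp)
    rw [Function.update_idem] at h₂
    exact (runWithin_forEach_cons hc h₁ h₂ r).mono (by simp; omega)

theorem runWithin_copy {k l m : J} (hkl : k ≠ l) (hkm : k ≠ m) (hlm : l ≠ m) (b : Bool)
    (r : Option Symbol) (S : J → List Symbol) {n : ℕ} (hk : S k = unary n) (hl : S l = [])
    (hm : S m = []) :
    RunWithin (copy k l m) (b, r) S (7 * n + 4) (b, none) (Function.update S l (unary n)) := by
  -- the first loop turns the number on `k` into copies on `l` and `m`
  have key : ∀ (n c d : ℕ) (r : Option Symbol) (S : J → List Symbol), S k = unary n →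
      S l = unary c → S m = unary d →
      RunWithin (forEach k ((count l).seq (count m))) (b, r) S (4 * n + 2) (b, none)
        (Function.update (Function.update (Function.update S k []) l (unary (c + n))) m
          (unary (d + n))) := by
    intro n
    induction n with
    | zero =>
      intro c d r S hk hl hm
      have : Function.update (Function.update (Function.update S k []) l (unary (c + 0))) m
          (unary (d + 0)) = S := by
        rw [← show S k = [] from hk, Nat.add_zero, Nat.add_zero, ← hl, ← hm]
        simp
      rw [this]
      exact runWithin_forEach_nil _ hk b r
    | succ n ih =>
      intro c d r S hk hl hm
      have h₁ := (runWithin_count l (b, some tick) (Function.update S k (unary n))).seq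
        (runWithin_count m _ _)
      refine (runWithin_forEach_cons (show S k = tick :: unary n from hk) h₁
        (ih (c + 1) (d + 1) (some tick) _ (by simp [hkl, hkm])
          (by simp [hkl.symm, hlm, hl, List.replicate_succ])
          (by simp [hkm.symm, hlm.symm, hm, List.replicate_succ])) r).congr (by omega) ?_
      funext j
      by_cases hjm : j = m
      · subst hjm; simp; omega
      · by_cases hjl : j = l
        · subst hjl; simp [hjm]; omega
        · by_cases hjk : j = k
          · subst hjk; simp [hjm, hjl]
          · simp [hjm, hjl, hjk]
  have h₁ := key n 0 0 r S hk hl hm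
  have h₂ := h₁.seq (runWithin_move hkm.symm b none _)
  refine h₂.congr (by simp; omega) ?_
  funext j
  by_cases hjk : j = k
  · subst hjk; simp [hkl, hkm, hk]
  · by_cases hjm : j = m
    · subst hjm; simp [hjk, hlm.symm, hm]
    · by_cases hjl : j = l
      · subst hjl; simp [hjk, hjm]
      · simp [hjk, hjm, hjl]

end Prog

/-! ### Reading the adjacency matrix -/

section Encoding

theorem getElem?_flatMap_of_length_eq {α β : Type*} {f : α → List β} {c : ℕ}
    (hf : ∀ a, (f a).length = c) (l : List α) {i j : ℕ} (hj : j < c) {a : α} (hi : l[i]? = some a) :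
    (l.flatMap f)[i * c + j]? = (f a)[j]? := by
  induction l generalizing i with
  | nil => simp at hi
  | cons x l ih =>
    rw [List.flatMap_cons]
    cases i with
    | zero =>
      obtain rfl : x = a := by simpa using hi
      rw [Nat.zero_mul, Nat.zero_add, List.getElem?_append_left (by rw [hf]; exact hj)]
    | succ i =>
      rw [List.getElem?_append_right (by rw [hf]; nlinarith), hf, ← ih (i := i) (by simpa using hi)]
      congr 1
      rw [Nat.succ_mul]
      omega

theorem finRange_getElem? {n : ℕ} (i : Fin n) : (List.finRange n)[i.val]? = some i := by
  rw [List.getElem?_eq_getElem (by simp)]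
  simp

open Classical in
/-- A row of the encoding takes `I.1 + 2` symbols: one for each of the `I.1 + 1` vertices, and the
separator. -/
theorem encodeGraph_getElem? (I : GraphInstance) (i j : Fin (I.1 + 1)) :
    (encodeGraph I)[i.val * (I.1 + 2) + j.val]? = some (some (decide (I.2.Adj i j))) := by
  unfold encodeGraph
  refine (getElem?_flatMap_of_length_eq (c := I.1 + 2) (a := i) ?_ _ (by omega)
    (finRange_getElem? i)).trans ?_
  · simp
  · rw [List.getElem?_append_left (by simp; omega), List.getElem?_map, finRange_getElem?]
    rfl

theorem encodeGraph_getElem?_sep (I : GraphInstance) (i : Fin (I.1 + 1)) :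
    (encodeGraph I)[i.val * (I.1 + 2) + (I.1 + 1)]? = some none := by
  unfold encodeGraph
  refine (getElem?_flatMap_of_length_eq (c := I.1 + 2) (a := i) ?_ _ (by omega)
    (finRange_getElem? i)).trans ?_
  · simp
  · simp

theorem length_encodeGraph (I : GraphInstance) :
    (encodeGraph I).length = (I.1 + 1) * (I.1 + 2) := by
  simp [encodeGraph, List.length_flatMap]

end Encoding

namespace Prog

variable {J : Type} [DecidableEq J]
variable {b : Bool} {r : Option Symbol} {S : J → List Symbol}

/-- Decide whether the stacks `k` and `l` contain the same number in unary, and empty them. -/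
def compare (k l : J) : Prog J Symbol Register :=
  (setBit true).seq ((forEach k ((fetch l).seq (.load fun v => (v.1 && v.2.isSome, v.2)))).seq
    (forEach l (setBit false)))

theorem runWithin_compare {k l : J} (hkl : k ≠ l) {m n : ℕ} (hk : S k = unary m)
    (hl : S l = unary n) : RunWithin (compare k l) (b, r) S (4 * m + 3 * n + 5)
      (decide (m = n), none) (Function.update (Function.update S k []) l []) := by
  -- the first loop finds out whether `m ≤ n`, and leaves `n - m` on the stack `l`
  have h₁ : ∀ (m n : ℕ) (b : Bool) (r : Option Symbol) (S : J → List Symbol), S k = unary m →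
      S l = unary n → RunWithin (forEach k ((fetch l).seq
        (.load fun v => (v.1 && v.2.isSome, v.2)))) (b, r) S (4 * m + 2)
        (b && decide (m ≤ n), none)
        (Function.update (Function.update S k []) l (unary (n - m))) := by
    intro m
    induction m with
    | zero =>
      intro n b r S hk hl
      rw [← show S k = [] from hk, Function.update_eq_self, Nat.sub_zero, ← hl,
        Function.update_eq_self]
      simpa using runWithin_forEach_nil _ hk b r
    | succ m ih =>
      intro n b r S hk hl
      have hl' : Function.update S k (unary m) l = unary n := by simp [hkl.symm, hl]
      have h := (runWithin_fetch l b (some tick) (Function.update S k (unary m))).seq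
        (RunWithin.load (fun v : Register => (v.1 && v.2.isSome, v.2)) _ _)
      have h' := runWithin_forEach_cons (show S k = tick :: unary m from hk) h
        (ih (n - 1) _ _ _ (by simp [hkl]) (by simp [hl', -Function.update_of_ne])) r
      have e : (b && (Function.update S k (unary m) l).head?.isSome && decide (m ≤ n - 1)) =
          (b && decide (m + 1 ≤ n)) := by
        rw [hl', Bool.and_assoc]
        congr 1
        cases n <;> simp
      dsimp only at h'
      rw [e] at h'
      refine h'.congr (by omega) ?_
      funext j
      by_cases hj : j = l
      · subst hj
        simp
        omega
      · by_cases hj' : j = k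
        · subst hj'; simp [hj]
        · simp [hj, hj']
  have h₂ : ∀ (n : ℕ) (b : Bool) (r : Option Symbol) (S : J → List Symbol), S l = unary n →
      RunWithin (forEach l (setBit false)) (b, r) S (3 * n + 2) (b && decide (n = 0), none)
        (Function.update S l []) := by
    intro n
    induction n with
    | zero =>
      intro b r S hl
      rw [← show S l = [] from hl, Function.update_eq_self]
      simpa using runWithin_forEach_nil _ hl b r
    | succ n ih =>
      intro b r S hl
      have h' := runWithin_forEach_cons (show S l = tick :: unary n from hl)
        (runWithin_setBit false b (some tick) _) (ih _ _ _ (by simp)) r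
      simpa using h'.congr (N := 3 * (n + 1) + 2) (by omega) rfl
  have h := (runWithin_setBit true b r S).seq ((h₁ m n true r S hk hl).seq
    (h₂ (n - m) _ _ _ (by simp)))
  have e : (true && decide (m ≤ n) && decide (n - m = 0)) = decide (m = n) := by
    rw [Bool.true_and, ← Bool.decide_and]
    congr 1
    apply propext
    omega
  rw [e] at h
  exact h.congr (by omega) (by simp)

/-- Move one symbol of the input from the stack `k` to the stack `l`, and keep it in the
register. -/
def advance (k l : J) : Prog J Symbol Register := (fetch k).seq (store l)

/-- Move symbols from the stack `k` to the stack `l` up to the next separator. -/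
def skipRow (k l : J) : Prog J Symbol Register :=
  forget.seq (.loop (fun v => v.2 != some none) (advance k l))

/-- The stacks when the first `n` symbols of the list `w` have been moved from the stack `k` to the
stack `l`. -/
def split (S : J → List Symbol) (k l : J) (w : List Symbol) (n : ℕ) : J → List Symbol :=
  Function.update (Function.update S k (w.drop n)) l (w.take n).reverse

theorem split_zero {k l : J} {w : List Symbol} (hk : S k = w) (hl : S l = []) :
    split S k l w 0 = S := by
  rw [split, List.drop_zero, ← hk, Function.update_eq_self, List.take_zero, List.reverse_nil, ← hl,
    Function.update_eq_self]

theorem runWithin_advance {k l : J} (hkl : k ≠ l) {w : List Symbol} {n : ℕ} {a : Symbol}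
    (hn : w[n]? = some a) : RunWithin (advance k l) (b, r) (split S k l w n) 2 (b, some a)
      (split S k l w (n + 1)) := by
  have hd : w.drop n = a :: w.drop (n + 1) := by
    obtain ⟨h, rfl⟩ := List.getElem?_eq_some_iff.1 hn
    exact List.drop_eq_getElem_cons h
  have ht : (w.take (n + 1)).reverse = a :: (w.take n).reverse := by
    rw [List.take_add_one, hn]
    simp
  have hk : split S k l w n k = a :: w.drop (n + 1) := by
    simp [split, hkl, hd]
  have h := runWithin_fetch k b r (split S k l w n)
  rw [hk] at h
  refine (h.seq (runWithin_store l b a _)).congr le_rfl ?_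
  funext j
  by_cases hj : j = l
  · subst hj; simp [split, hkl.symm, ht]
  · by_cases hj' : j = k
    · subst hj'; simp [split, hj]
    · simp [split, hj, hj']

theorem runWithin_skipRow {k l : J} (hkl : k ≠ l) (I : GraphInstance) (i : Fin (I.1 + 1)) :
    RunWithin (skipRow k l) (b, r) (split S k l (encodeGraph I) (i * (I.1 + 2)))
      (3 * I.1 + 8) (b, some none) (split S k l (encodeGraph I) ((i + 1) * (I.1 + 2))) := by
  classical
  have key : ∀ m j (r : Option Symbol), j + m = I.1 + 1 → r ≠ some none →
      RunWithin (.loop (fun v => v.2 != some none) (advance k l)) (b, r)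
        (split S k l (encodeGraph I) (i * (I.1 + 2) + j)) (3 * m + 4) (b, some none)
        (split S k l (encodeGraph I) ((i + 1) * (I.1 + 2))) := by
    intro m
    induction m with
    | zero =>
      intro j r hj hr
      obtain rfl : j = I.1 + 1 := by omega
      refine (RunWithin.loop_true (by simpa using hr) (runWithin_advance hkl
        (encodeGraph_getElem?_sep I i)) (.loop_false _ _ (by simp))).congr (by omega) ?_
      congr 1
      rw [Nat.succ_mul]
      omega
    | succ m ih =>
      intro j r hj hr
      exact (RunWithin.loop_true (by simpa using hr) (runWithin_advance hkl
        (encodeGraph_getElem? I i ⟨j, by omega⟩)) (ih (j + 1) _ (by omega) (by simp))).mono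
        (by omega)
  exact ((runWithin_forget b r _).seq (key (I.1 + 1) 0 none (by omega) (by simp))).mono (by omega)

/-- Skip as many rows of the input as given by the unary number on the stack `m`. -/
def skipRows (k l m : J) : Prog J Symbol Register := forEach m (skipRow k l)

/-- Skip as many symbols of the input as given by the unary number on the stack `m`. -/
def skipSymbols (k l m : J) : Prog J Symbol Register := forEach m (advance k l)

theorem update_split {k l m : J} (hkm : k ≠ m) (hlm : l ≠ m) (w : List Symbol) (n : ℕ)
    (x : List Symbol) :
    Function.update (split S k l w n) m x = split (Function.update S m x) k l w n := by
  rw [split, Function.update_comm hlm, Function.update_comm hkm, split]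

theorem runWithin_skipRows {k l m : J} (hkl : k ≠ l) (hkm : k ≠ m) (hlm : l ≠ m)
    (I : GraphInstance) (n : ℕ) : ∀ (i : ℕ) (r : Option Symbol) (S : J → List Symbol),
    i + n < I.1 + 1 → S m = unary n →
    RunWithin (skipRows k l m) (b, r) (split S k l (encodeGraph I) (i * (I.1 + 2)))
      (n * (3 * I.1 + 10) + 2) (b, none)
      (split (Function.update S m []) k l (encodeGraph I) ((i + n) * (I.1 + 2))) := by
  have hmS : ∀ (S : J → List Symbol) w i, split S k l w i m = S m := by
    intro S w i
    simp [split, hkm.symm, hlm.symm]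
  induction n with
  | zero =>
    intro i r S _ hm
    have h := runWithin_forEach_nil (S := split S k l (encodeGraph I) (i * (I.1 + 2)))
      (skipRow k l) ((hmS ..).trans hm) b r
    refine h.congr (by omega) ?_
    rw [show i + 0 = i from rfl, ← show S m = [] from hm, Function.update_eq_self]
  | succ n ih =>
    intro i r S hi hm
    have h₁ := runWithin_skipRow (b := b) (r := some tick) (S := Function.update S m (unary n))
      hkl I ⟨i, by omega⟩
    rw [← update_split hkm hlm] at h₁
    have h₂ := ih (i + 1) (some none) (Function.update S m (unary n)) (by omega) (by simp)
    refine (runWithin_forEach_cons ((hmS ..).trans hm) h₁ h₂ r).congr ?_ ?_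
    · rw [Nat.add_one_mul n]; omega
    · rw [Function.update_idem, show i + 1 + n = i + (n + 1) by omega]

theorem runWithin_skipSymbols {k l m : J} (hkl : k ≠ l) (hkm : k ≠ m) (hlm : l ≠ m)
    (w : List Symbol) (n : ℕ) : ∀ (i : ℕ) (r : Option Symbol) (S : J → List Symbol),
    i + n ≤ w.length → S m = unary n →
    RunWithin (skipSymbols k l m) (b, r) (split S k l w i) (4 * n + 2) (b, none)
      (split (Function.update S m []) k l w (i + n)) := by
  have hmS : ∀ (S : J → List Symbol) w i, split S k l w i m = S m := by
    intro S w i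
    simp [split, hkm.symm, hlm.symm]
  induction n with
  | zero =>
    intro i r S _ hm
    have h := runWithin_forEach_nil (S := split S k l w i) (advance k l) ((hmS ..).trans hm) b r
    refine h.congr (by omega) ?_
    rw [← show S m = [] from hm, Function.update_eq_self, Nat.add_zero]
  | succ n ih =>
    intro i r S hi hm
    have h₁ := runWithin_advance (b := b) (r := some tick) (S := Function.update S m (unary n))
      hkl (List.getElem?_eq_getElem (show i < w.length by omega))
    rw [← update_split hkm hlm] at h₁
    have h₂ := ih (i + 1) (some w[i]) (Function.update S m (unary n)) (by omega) (by simp)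
    refine (runWithin_forEach_cons ((hmS ..).trans hm) h₁ h₂ r).congr (by omega) ?_
    rw [Function.update_idem, show i + 1 + n = i + (n + 1) by omega]

/-- Look up the entry of the adjacency matrix whose row and column are given by the unary numbers
on the stacks `m` and `m'`, which are emptied. The matrix is read from the stack `k`, with the help
of the stack `l`. -/
def lookup (k l m m' : J) : Prog J Symbol Register :=
  (skipRows k l m).seq ((skipSymbols k l m').seq ((advance k l).seq
    ((Prog.load fun v => (v.2 == some (some true), none)).seq (move l k))))

open Classical in
theorem runWithin_lookup {k l m m' : J} (hkl : k ≠ l) (hkm : k ≠ m) (hlm : l ≠ m)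
    (hkm' : k ≠ m') (hlm' : l ≠ m') (hmm' : m ≠ m') (I : GraphInstance) (x y : Fin (I.1 + 1))
    (hk : S k = encodeGraph I) (hl : S l = []) (hm : S m = unary x) (hm' : S m' = unary y) :
    RunWithin (lookup k l m m') (b, r) S (20 * (encodeGraph I).length + 20)
      (decide (I.2.Adj x y), none) (Function.update (Function.update S m []) m' []) := by
  have hget := encodeGraph_getElem? I x y
  have hlen := length_encodeGraph I
  have hlt := (List.getElem?_eq_some_iff.1 hget).1
  have h₁ := runWithin_skipRows (b := b) hkl hkm hlm I x 0 r S (by omega) hm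
  rw [Nat.zero_mul, split_zero hk hl, Nat.zero_add] at h₁
  have h₂ := runWithin_skipSymbols (b := b) hkl hkm' hlm' (encodeGraph I) y (x * (I.1 + 2)) none
    (Function.update S m []) hlt.le (by simp [hmm'.symm, hm'])
  have h₃ := runWithin_advance (b := b) (r := none)
    (S := Function.update (Function.update S m []) m' []) hkl hget
  have h₄ := RunWithin.load (fun v : Register => (v.2 == some (some true), (none : Option Symbol)))
    (b, some (some (decide (I.2.Adj x y))))
    (split (Function.update (Function.update S m []) m' []) k l (encodeGraph I)
      (x * (I.1 + 2) + y + 1))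
  have h₅ := h₁.seq (h₂.seq (h₃.seq (h₄.seq (runWithin_move hkl.symm _ none _))))
  have e : (some (some (decide (I.2.Adj x y))) == some (some true)) = decide (I.2.Adj x y) := by
    by_cases h : I.2.Adj x y <;> simp [h]
  rw [e] at h₅
  refine h₅.congr ?_ ?_
  · have hx : x.val ≤ I.1 := by omega
    have hy : y.val ≤ I.1 := by omega
    simp only [split, Function.update_self, List.length_reverse, List.length_take]
    have h1 : x.val * (3 * I.1 + 10) ≤ I.1 * (3 * I.1 + 10) := Nat.mul_le_mul_right _ hx
    have h2 : min (x * (I.1 + 2) + y + 1) (encodeGraph I).length ≤ (encodeGraph I).length :=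
      min_le_right _ _
    rw [hlen] at *
    nlinarith
  · funext j
    by_cases hj : j = k
    · subst hj; simp [split, hkl, hkm, hkm', hk]
    · by_cases hj' : j = l
      · subst hj'; simp [split, hj, hlm, hlm', hl]
      · simp [split, hj, hj']

/-- Write the order of the graph in unary onto the stack `m`. The adjacency matrix is read from the
stack `k`, with the help of the stack `l`. -/
def readOrder (k l m : J) : Prog J Symbol Register :=
  (advance k l).seq ((Prog.loop (fun v => v.2 != some none) ((count m).seq (advance k l))).seq
    (move l k))

theorem runWithin_readOrder {k l m : J} (hkl : k ≠ l) (hkm : k ≠ m) (hlm : l ≠ m)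
    (I : GraphInstance) (hk : S k = encodeGraph I) (hl : S l = []) (hm : S m = []) :
    RunWithin (readOrder k l m) (b, r) S (10 * (encodeGraph I).length + 10)
      (b, none) (Function.update S m (unary (I.1 + 1))) := by
  classical
  have hmS : ∀ (S : J → List Symbol) w i, split S k l w i m = S m := by
    intro S w i
    simp [split, hkm.symm, hlm.symm]
  have key : ∀ n j (a : Symbol) (S : J → List Symbol), j + n = I.1 + 1 → S m = unary j →
      (encodeGraph I)[j]? = some a →
      RunWithin (.loop (fun v => v.2 != some none) ((count m).seq (advance k l)))
        (b, some a) (split S k l (encodeGraph I) (j + 1)) (4 * n + 1) (b, some none)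
        (split (Function.update S m (unary (I.1 + 1))) k l (encodeGraph I) (I.1 + 2)) := by
    intro n
    induction n with
    | zero =>
      intro j a S hj hm ha
      obtain rfl : j = I.1 + 1 := by omega
      have hsep := encodeGraph_getElem?_sep I 0
      rw [Fin.val_zero, Nat.zero_mul, Nat.zero_add, ha] at hsep
      obtain rfl := Option.some.inj hsep
      rw [← hm, Function.update_eq_self]
      exact .loop_false _ _ (by simp)
    | succ n ih =>
      intro j a S hj hm ha
      have hrow := encodeGraph_getElem? I 0 ⟨j, by omega⟩
      rw [Fin.val_zero, Nat.zero_mul, Nat.zero_add, ha] at hrow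
      obtain rfl := Option.some.inj hrow
      have hlt : j + 1 < (encodeGraph I).length := by
        rw [length_encodeGraph]
        nlinarith
      have h₁ := runWithin_count m (b, some (some (decide (I.2.Adj 0 ⟨j, by omega⟩))))
        (split S k l (encodeGraph I) (j + 1))
      rw [hmS, hm, update_split hkm hlm] at h₁
      have h₂ := ih (j + 1) _ (Function.update S m (unary (j + 1))) (by omega) (by simp)
        (List.getElem?_eq_getElem hlt)
      rw [Function.update_idem] at h₂
      exact (RunWithin.loop_true (by simp) (h₁.seq (runWithin_advance hkl
        (List.getElem?_eq_getElem hlt))) h₂).mono (by omega)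
  have h₀ := encodeGraph_getElem? I 0 0
  rw [Fin.val_zero, Nat.zero_mul, Nat.zero_add] at h₀
  have h₁ := runWithin_advance (b := b) (r := r) (S := S) hkl h₀
  rw [split_zero hk hl] at h₁
  refine (h₁.seq ((key (I.1 + 1) 0 _ S (by omega) hm h₀).seq
    (runWithin_move hkl.symm b _ _))).congr ?_ ?_
  · simp only [split, Function.update_self, List.length_reverse, List.length_take]
    have h2 : min (I.1 + 2) (encodeGraph I).length ≤ I.1 + 2 := min_le_left _ _
    rw [length_encodeGraph] at *
    nlinarith
  · funext j
    by_cases hj : j = k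
    · subst hj; simp [split, hkl, hkm, hk]
    · by_cases hj' : j = l
      · subst hj'; simp [split, hj, hlm, hl]
      · simp [split, hj, hj']

end Prog

/-! ### First-order properties of graphs -/

section Definability

open Prog

/-- The stacks of the programs that evaluate first-order formulas with `q` variables. -/
inductive StackName (q : ℕ) : Type
  | input
  | rest
  | tmp
  | left
  | right
  | order
  | var (j : Fin q)
  | ctr (j : Fin q)
  deriving DecidableEq, Fintype

variable {q : ℕ}

/-- The stacks at the start and at the end of the evaluation of a formula whose free variables are
among the first `d` ones, with values given by `ρ`: the stack `input` contains the graph, `order`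
its order, and `var j` the value of the variable `j < d`, in unary. The stacks `ctr j` for `j < d`,
with contents given by `C`, are the loop counters of quantifiers. -/
noncomputable def evalStacks (I : GraphInstance) (ρ : Fin q → Fin (I.1 + 1))
    (C : Fin q → List Symbol) (d : ℕ) : StackName q → List Symbol
  | .input => encodeGraph I
  | .order => unary (I.1 + 1)
  | .var j => if j.val < d then unary (ρ j) else []
  | .ctr j => if j.val < d then C j else []
  | _ => []

/-- A property of a graph and of the values of `q` variables is definable if it can be evaluated in
polynomial time by a program that only depends on the values of the first `d` variables, and that
leaves all stacks as they were. The loop counters of outer quantifiers have arbitrary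
contents `C`. -/
def Definable (d : ℕ) (φ : ∀ I : GraphInstance, (Fin q → Fin (I.1 + 1)) → Prop) : Prop :=
  ∃ (p : Prog (StackName q) Symbol Register) (P : Polynomial ℕ), ∀ I ρ C b, ∃ b',
    (b' = true ↔ φ I ρ) ∧ RunWithin p (b, none) (evalStacks I ρ C d)
      (P.eval (encodeGraph I).length) (b', none) (evalStacks I ρ C d)

namespace Definable

variable {d : ℕ} {φ ψ : ∀ I : GraphInstance, (Fin q → Fin (I.1 + 1)) → Prop}

theorem congr (h : Definable d φ) (hφ : ∀ I ρ, φ I ρ ↔ ψ I ρ) : Definable d ψ := by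
  have : φ = ψ := by
    funext I ρ
    exact propext (hφ I ρ)
  rwa [← this]

theorem const (P : Prop) : Definable (q := q) d fun _ _ => P := by
  classical
  exact ⟨setBit (decide P), 1, fun I ρ C b => ⟨decide P, by simp,
    by simpa using runWithin_setBit (decide P) b none _⟩⟩

theorem not (h : Definable d φ) : Definable d fun I ρ => ¬ φ I ρ := by
  obtain ⟨p, P, h⟩ := h
  refine ⟨p.seq (.load fun v => (!v.1, v.2)), P + 1, fun I ρ C b => ?_⟩
  obtain ⟨b', hb', hr⟩ := h I ρ C b
  refine ⟨!b', by simp [← hb'], ?_⟩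
  simpa using hr.seq (RunWithin.load (fun v : Register => (!v.1, v.2)) _ _)

theorem and (h₁ : Definable d φ) (h₂ : Definable d ψ) :
    Definable d fun I ρ => φ I ρ ∧ ψ I ρ := by
  obtain ⟨p₁, P₁, h₁⟩ := h₁
  obtain ⟨p₂, P₂, h₂⟩ := h₂
  refine ⟨p₁.seq (.ite (fun v => v.1) p₂ forget), P₁ + (P₂ + 2), fun I ρ C b => ?_⟩
  obtain ⟨b₁, hb₁, hr₁⟩ := h₁ I ρ C b
  cases b₁ with
  | true =>
    obtain ⟨b₂, hb₂, hr₂⟩ := h₂ I ρ C true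
    refine ⟨b₂, by simp [hb₂, ← hb₁], (hr₁.seq (.ite_true _ rfl hr₂)).mono ?_⟩
    simp only [Polynomial.eval_add, Polynomial.eval_ofNat]
    omega
  | false =>
    refine ⟨false, by simp [← hb₁], (hr₁.seq (.ite_false _ rfl (runWithin_forget _ _ _))).mono ?_⟩
    simp only [Polynomial.eval_add, Polynomial.eval_ofNat]
    omega

theorem or (h₁ : Definable d φ) (h₂ : Definable d ψ) :
    Definable d fun I ρ => φ I ρ ∨ ψ I ρ :=
  (h₁.not.and h₂.not).not.congr fun _ _ => by tauto

theorem iff (h₁ : Definable d φ) (h₂ : Definable d ψ) :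
    Definable d fun I ρ => (φ I ρ ↔ ψ I ρ) :=
  ((h₁.and h₂).or (h₁.not.and h₂.not)).congr fun _ _ => by tauto

theorem exists_lt (n : ℕ) {φ : ℕ → ∀ I : GraphInstance, (Fin q → Fin (I.1 + 1)) → Prop}
    (h : ∀ m < n, Definable d (φ m)) : Definable d fun I ρ => ∃ m < n, φ m I ρ := by
  induction n with
  | zero => exact (const False).congr fun I ρ => by simp
  | succ n ih =>
    exact ((ih fun m hm => h m (by omega)).or (h n (by omega))).congr fun I ρ => by
      simp only [Nat.lt_succ_iff_lt_or_eq, or_and_right, exists_or, exists_eq_left]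

theorem le_length_encodeGraph (I : GraphInstance) : I.1 + 1 ≤ (encodeGraph I).length := by
  rw [length_encodeGraph]
  nlinarith

theorem runWithin_copy_vars (I : GraphInstance) (ρ : Fin q → Fin (I.1 + 1))
    (C : Fin q → List Symbol) {i j : Fin q} (hi : i.val < d) (hj : j.val < d) (b : Bool) :
    RunWithin ((copy (.var i) .left .tmp).seq (copy (.var j) .right .tmp)) (b, none)
      (evalStacks I ρ C d) (14 * (encodeGraph I).length + 8) (b, none)
      (Function.update (Function.update (evalStacks I ρ C d) .left (unary (ρ i)))
        .right (unary (ρ j))) := by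
  have h₁ := runWithin_copy (k := .var i) (l := .left) (m := .tmp) (by simp) (by simp) (by simp) b
    none (evalStacks I ρ C d) (n := ρ i) (by simp [evalStacks, hi]) rfl rfl
  have h₂ := runWithin_copy (k := .var j) (l := .right) (m := .tmp) (by simp) (by simp) (by simp) b
    none (Function.update (evalStacks I ρ C d) .left (unary (ρ i))) (n := ρ j)
    (by simp [evalStacks, hj]) (by simp [evalStacks]) (by simp [evalStacks])
  have hle := le_length_encodeGraph I
  exact (h₁.seq h₂).mono (by omega)

theorem evalStacks_restore (I : GraphInstance) (ρ : Fin q → Fin (I.1 + 1))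
    (C : Fin q → List Symbol) (x y : List Symbol) :
    Function.update (Function.update (Function.update (Function.update (evalStacks I ρ C d)
      .left x) .right y) .left []) .right [] = evalStacks I ρ C d := by
  funext k
  cases k <;> simp [evalStacks]

theorem eq {i j : Fin q} (hi : i.val < d) (hj : j.val < d) :
    Definable d fun _ ρ => ρ i = ρ j := by
  refine ⟨((copy (.var i) .left .tmp).seq (copy (.var j) .right .tmp)).seq (compare .left .right),
    21 * Polynomial.X + 20, fun I ρ C b => ⟨decide ((ρ i).val = ρ j), by simp [Fin.ext_iff], ?_⟩⟩
  have h := (runWithin_copy_vars I ρ C hi hj b).seq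
    (runWithin_compare (k := .left) (l := .right) (by simp) (m := ρ i) (n := ρ j)
      (by simp) (by simp))
  have hle := le_length_encodeGraph I
  refine h.congr ?_ (evalStacks_restore I ρ C _ _)
  simp
  omega

theorem adj {i j : Fin q} (hi : i.val < d) (hj : j.val < d) :
    Definable d fun I ρ => I.2.Adj (ρ i) (ρ j) := by
  classical
  refine ⟨((copy (.var i) .left .tmp).seq (copy (.var j) .right .tmp)).seq
    (lookup .input .rest .left .right), 34 * Polynomial.X + 28,
    fun I ρ C b => ⟨decide (I.2.Adj (ρ i) (ρ j)), by simp, ?_⟩⟩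
  have h := (runWithin_copy_vars I ρ C hi hj b).seq
    (runWithin_lookup (k := .input) (l := .rest) (m := .left) (m' := .right) (by simp) (by simp)
      (by simp) (by simp) (by simp) (by simp) I (ρ i) (ρ j) (by simp [evalStacks])
      (by simp [evalStacks]) (by simp) (by simp))
  refine h.congr ?_ (evalStacks_restore I ρ C _ _)
  simp
  omega

/-- The body of the loop over all vertices that evaluates a quantifier. -/
def existsBody (i : Fin q) (p : Prog (StackName q) Symbol Register) :
    Prog (StackName q) Symbol Register :=
  forget.seq ((Prog.ite (fun v => v.1) forget p).seq (count (.var i)))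

/-- An existential quantifier over the variable `d` is evaluated by a loop over all vertices. -/
theorem ex (hd : d < q) (h : Definable (d + 1) φ) :
    Definable d fun I ρ => ∃ v, φ I (Function.update ρ ⟨d, hd⟩ v) := by
  classical
  obtain ⟨p, P, h⟩ := h
  refine ⟨(copy .order (.ctr ⟨d, hd⟩) .tmp).seq ((setBit false).seq
    ((forEach (.ctr ⟨d, hd⟩) (existsBody ⟨d, hd⟩ p)).seq (clear (.var ⟨d, hd⟩)))),
    Polynomial.X * (P + 6) + 10 * Polynomial.X + 20, fun I ρ C b =>
      ⟨decide (∃ v, φ I (Function.update ρ ⟨d, hd⟩ v)), by simp, ?_⟩⟩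
  set i : Fin q := ⟨d, hd⟩ with hi
  set L := (encodeGraph I).length with hL
  -- the stacks when the quantified variable is `m` and the loop counter is `n`
  let T : ℕ → ℕ → StackName q → List Symbol := fun m n =>
    Function.update (Function.update (evalStacks I ρ C d) (.ctr i) (unary n)) (.var i) (unary m)
  have hT : ∀ (v : Fin (I.1 + 1)) n, evalStacks I (Function.update ρ i v)
      (Function.update C i (unary n)) (d + 1) = T v n := by
    intro v n
    funext k
    cases k with
    | var j =>
      by_cases hj : j = i
      · subst hj; simp [T, evalStacks, hi]
      · have : j.val ≠ d := fun h => hj (Fin.ext h)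
        have : j.val < d + 1 ↔ j.val < d := by omega
        simp [T, evalStacks, hj, this]
    | ctr j =>
      by_cases hj : j = i
      · subst hj; simp [T, evalStacks, hi]
      · have : j.val ≠ d := fun h => hj (Fin.ext h)
        have : j.val < d + 1 ↔ j.val < d := by omega
        simp [T, evalStacks, hj, this]
    | _ => simp [T, evalStacks]
  -- the truth value tells whether one of the vertices below `m` is a witness
  have key : ∀ n m (b : Bool) (r : Option Symbol), m + n = I.1 + 1 →
      (b = true ↔ ∃ v : Fin (I.1 + 1), v.val < m ∧ φ I (Function.update ρ i v)) →
      RunWithin (forEach (.ctr i) (existsBody i p)) (b, r) (T m n) (n * (P.eval L + 6) + 2)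
        (decide (∃ v, φ I (Function.update ρ i v)), none) (T (I.1 + 1) 0) := by
    intro n
    induction n with
    | zero =>
      intro m b r hm hb
      obtain rfl : m = I.1 + 1 := by omega
      have : decide (∃ v, φ I (Function.update ρ i v)) = b := by
        rw [Bool.eq_iff_iff, hb, decide_eq_true_iff]
        exact exists_congr fun v => (and_iff_right v.isLt).symm
      rw [this]
      exact (runWithin_forEach_nil _ (by simp [T]) b r).mono (by omega)
    | succ n ih =>
      intro m b r hm hb
      have hm' : m < I.1 + 1 := by omega
      have hupd : Function.update (T m (n + 1)) (.ctr i) (unary n) = T m n := by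
        simp [T, Function.update_comm]
      have hcount : Function.update (T m n) (.var i) (tick :: T m n (.var i)) = T (m + 1) n := by
        simp [T, List.replicate_succ]
      obtain ⟨b', hb', hr⟩ := h I (Function.update ρ i ⟨m, hm'⟩) (Function.update C i (unary n)) b
      rw [hT, ← hL] at hr
      have hite : RunWithin (Prog.ite (fun v => v.1) forget p) (b, none) (T m n)
          (P.eval L + 2) (b || b', none) (T m n) := by
        cases b with
        | true => exact (RunWithin.ite_true _ rfl (runWithin_forget _ _ _)).mono (by omega)
        | false => exact (RunWithin.ite_false _ rfl hr).mono (by omega)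
      have hbody := (runWithin_forget b (some tick) (T m n)).seq
        (hite.seq (runWithin_count (.var i) _ _))
      rw [hcount, ← hupd] at hbody
      refine (runWithin_forEach_cons (show T m (n + 1) (.ctr i) = tick :: unary n by
        simp [T, List.replicate_succ]) hbody (ih (m + 1) _ none (by omega) ?_) r).mono ?_
      · rw [Bool.or_eq_true, hb, hb']
        constructor
        · rintro (⟨v, hv, hφ⟩ | hφ)
          · exact ⟨v, by omega, hφ⟩
          · exact ⟨_, by simp, hφ⟩
        · rintro ⟨v, hv, hφ⟩
          rcases Nat.lt_succ_iff_lt_or_eq.1 hv with hv | hv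
          · exact Or.inl ⟨v, hv, hφ⟩
          · obtain rfl : v = ⟨m, hm'⟩ := Fin.ext hv
            exact Or.inr hφ
      · rw [Nat.add_one_mul n]; omega
  have h₁ := runWithin_copy (k := .order) (l := .ctr i) (m := .tmp) (by simp) (by simp) (by simp) b
    none (evalStacks I ρ C d) (n := I.1 + 1) rfl (by simp [evalStacks, hi]) rfl
  have hT₀ : Function.update (evalStacks I ρ C d) (.ctr i) (unary (I.1 + 1)) = T 0 (I.1 + 1) := by
    funext k
    by_cases hk : k = .var i
    · subst hk; simp [T, evalStacks, hi]
    · simp [T, hk]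
  rw [hT₀] at h₁
  have h₂ := h₁.seq ((runWithin_setBit false b none _).seq ((key (I.1 + 1) 0 false none (by omega)
    (by simp)).seq (runWithin_clear (.var i) _ none _)))
  refine h₂.congr ?_ ?_
  · have hle := le_length_encodeGraph I
    simp [T]
    have := Nat.mul_le_mul_right (P.eval L + 6) hle
    simp only [← hL] at *
    omega
  · funext k
    by_cases hk : k = .var i
    · subst hk; simp [evalStacks, hi]
    · by_cases hk' : k = .ctr i
      · subst hk'; simp [T, evalStacks, hi]
      · simp [T, hk, hk']

theorem all (hd : d < q) (h : Definable (d + 1) φ) :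
    Definable d fun I ρ => ∀ v, φ I (Function.update ρ ⟨d, hd⟩ v) :=
  (h.not.ex hd).not.congr fun _ _ => by simp

/-- Quantifying over all of the first `d` variables. -/
theorem ex_prefix (hd : d ≤ q) (h : Definable d φ) :
    Definable 0 fun I ρ => ∃ ρ' : Fin q → Fin (I.1 + 1),
      (∀ j : Fin q, d ≤ j.val → ρ' j = ρ j) ∧ φ I ρ' := by
  induction d generalizing φ with
  | zero =>
    refine h.congr fun I ρ => ⟨fun h => ⟨ρ, fun _ _ => rfl, h⟩, ?_⟩
    rintro ⟨ρ', hρ, h⟩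
    obtain rfl : ρ' = ρ := funext fun j => hρ j (Nat.zero_le _)
    exact h
  | succ d ih =>
    refine (ih (by omega) (h.ex hd)).congr fun I ρ => ⟨?_, ?_⟩
    · rintro ⟨ρ', hρ, v, h⟩
      refine ⟨_, fun j hj => ?_, h⟩
      rw [Function.update_of_ne fun e => by rw [e] at hj; exact absurd hj (by simp)]
      exact hρ j (by omega)
    · rintro ⟨ρ', hρ, h⟩
      refine ⟨Function.update ρ' ⟨d, hd⟩ (ρ ⟨d, hd⟩), fun j hj => ?_, ρ' ⟨d, hd⟩, by simpa using h⟩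
      by_cases hjd : j = ⟨d, hd⟩
      · rw [hjd, Function.update_self]
      · rw [Function.update_of_ne hjd]
        refine hρ j ?_
        have : j.val ≠ d := fun e => hjd (Fin.ext e)
        omega

/-- A definable property without free variables is decidable in polynomial time. -/
theorem decidableInPolyTime {p : GraphInstance → Prop} (h : Definable (q := q) 0 fun I _ => p I) :
    DecidableInPolyTime p := by
  classical
  obtain ⟨prog, P, h⟩ := h
  refine ⟨fun I => decide (p I), by simp, ?_⟩
  refine nonempty_computableInPolyTime ((readOrder .input .rest .order).seq
    (prog.seq ((clear .input).seq (clear .order)))) .input (false, none) Prod.fst encodeGraph _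
    (P + 20 * Polynomial.X + 20) fun I => ?_
  have h₁ := runWithin_readOrder (k := .input) (l := .rest) (m := .order) (b := false) (r := none)
    (S := Function.update (fun _ : StackName q => []) .input (encodeGraph I)) (by simp) (by simp)
    (by simp) I (by simp) (by simp) (by simp)
  have hS : Function.update (Function.update (fun _ : StackName q => []) .input (encodeGraph I))
      .order (unary (I.1 + 1)) = evalStacks I (fun _ => 0) (fun _ => []) 0 := by
    funext k
    cases k <;> simp [evalStacks]
  rw [hS] at h₁
  obtain ⟨b', hb', hr⟩ := h I (fun _ => 0) (fun _ => []) false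
  obtain ⟨n, hn, hrun⟩ := h₁.seq (hr.seq ((runWithin_clear .input b' none _).seq
    (runWithin_clear .order b' none _)))
  refine ⟨n, (b', none), hn.trans ?_, ?_, ?_⟩
  · have hle := le_length_encodeGraph I
    simp [evalStacks]
    omega
  · rw [Bool.eq_iff_iff, hb', decide_eq_true_iff]
  · convert hrun using 1
    funext k
    cases k <;> simp [evalStacks]

end Definable

/-- The set of the values of the first `s` variables. -/
def initialSet {V : Type*} (s : ℕ) (ρ : Fin q → V) : Set V := {v | ∃ j : Fin q, j.val < s ∧ ρ j = v}

theorem initialSet_update {V : Type*} {s d : ℕ} (hsd : s ≤ d) (hd : d < q) (ρ : Fin q → V) (v : V) :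
    initialSet s (Function.update ρ ⟨d, hd⟩ v) = initialSet s ρ := by
  ext w
  refine exists_congr fun j => and_congr_right fun hj => ?_
  rw [Function.update_of_ne]
  rintro rfl
  simp at hj
  omega

/-- Being colored after a fixed number of timesteps is a first-order property: each timestep takes
at most two further quantified variables. -/
theorem definable_colored (s k : ℕ) : ∀ {d : ℕ} (i : Fin q), s ≤ d → i.val < d → d + 2 * k ≤ q →
    Definable d fun I ρ => ρ i ∈ colored I.2 (initialSet s ρ) k := by
  have hzero : ∀ {d : ℕ} (i : Fin q), s ≤ d → i.val < d → d ≤ q →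
      Definable d fun I ρ => ρ i ∈ colored I.2 (initialSet s ρ) 0 := by
    intro d i hsd hi hd
    refine (Definable.exists_lt s (φ := fun m I ρ => ∃ h : m < q, ρ ⟨m, h⟩ = ρ i)
      fun m hm => ?_).congr fun I ρ => ?_
    · have hmq : m < q := by omega
      exact (Definable.eq (i := ⟨m, hmq⟩) (show m < d by omega) hi).congr fun I ρ => by simp [hmq]
    · constructor
      · rintro ⟨m, hm, hmq, h⟩
        exact ⟨⟨m, hmq⟩, hm, h⟩
      · rintro ⟨j, hj, h⟩
        exact ⟨j, hj, j.isLt, h⟩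
  induction k with
  | zero => exact fun i hsd hi hd => hzero i hsd hi (by omega)
  | succ k ih =>
    intro d i hsd hi hd
    have hdq : d < q := by omega
    have hid : i ≠ ⟨d, hdq⟩ := fun e => by rw [e] at hi; simp at hi
    have hold := ih (d := d) i hsd hi (by omega)
    have hu := ih (d := d + 1) ⟨d, hdq⟩ (by omega) (Nat.lt_succ_self d) (by omega)
    cases k with
    | zero =>
      refine (hold.or ((hu.and (Definable.adj (i := ⟨d, hdq⟩) (j := i) (Nat.lt_succ_self d)
        (Nat.lt_succ_of_lt hi))).ex hdq)).congr fun I ρ => ?_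
      simp only [initialSet_update hsd, Function.update_self, Function.update_of_ne hid]
      exact Iff.rfl
    | succ k =>
      have hdq' : d + 1 < q := by omega
      have hid' : i ≠ ⟨d + 1, hdq'⟩ := fun e => by rw [e] at hi; simp at hi
      have hdd : (⟨d, hdq⟩ : Fin q) ≠ ⟨d + 1, hdq'⟩ := by simp
      have hw := ih (d := d + 2) ⟨d + 1, hdq'⟩ (by omega) (Nat.lt_succ_self _) (by omega)
      have hadj := Definable.adj (d := d + 2) (i := ⟨d, hdq⟩) (j := ⟨d + 1, hdq'⟩)
        (show d < d + 2 by omega) (show d + 1 < d + 2 by omega)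
      have heq := Definable.eq (d := d + 2) (i := ⟨d + 1, hdq'⟩) (j := i)
        (show d + 1 < d + 2 by omega) (by omega)
      refine (hold.or ((hu.and (((hadj.and hw.not).iff heq).all hdq')).ex hdq)).congr
        fun I ρ => ?_
      simp only [initialSet_update hsd, initialSet_update (hsd.trans (Nat.le_succ d)),
        Function.update_self, Function.update_of_ne hid, Function.update_of_ne hid',
        Function.update_of_ne hdd]
      exact Iff.rfl

theorem exists_initialSet {V : Type*} [Nonempty V] (S : Finset V) (hS : S.card ≤ q) :
    ∃ ρ : Fin q → V, initialSet S.card ρ = S := by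
  classical
  refine ⟨fun j => if h : j.val < S.card then (S.equivFin.symm ⟨j, h⟩ : V)
    else Classical.arbitrary V, ?_⟩
  ext v
  constructor
  · rintro ⟨j, hj, rfl⟩
    simp [hj]
  · intro hv
    refine ⟨⟨S.equivFin ⟨v, hv⟩, by omega⟩, by simp, by simp⟩

theorem exists_finset_initialSet {V : Type*} (s : ℕ) (ρ : Fin q → V) :
    ∃ S : Finset V, S.card ≤ s ∧ (S : Set V) = initialSet s ρ := by
  classical
  refine ⟨({j : Fin q | j.val < s} : Finset (Fin q)).image ρ, Finset.card_image_le.trans ?_, ?_⟩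
  · rw [Fin.card_filter_val_lt]
    exact min_le_right _ _
  · ext v
    simp [initialSet]

theorem structuralCondition_iff_exists_initialSet {t : ℕ} (I : GraphInstance) (hq : t ≤ q) :
    StructuralCondition t I.2 ↔ ∃ s < t + 1, ∃ ρ : Fin q → Fin (I.1 + 1),
      ∀ v, v ∈ colored I.2 (initialSet s ρ) (t - s) := by
  rw [← throttlingNumber_le_iff_structuralCondition, throttlingNumber_le_iff]
  constructor
  · rintro ⟨S, hS, hc⟩
    obtain ⟨ρ, hρ⟩ := exists_initialSet S (hS.trans hq)
    exact ⟨S.card, by omega, ρ, fun v => by simp [hρ, hc]⟩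
  · rintro ⟨s, hs, ρ, h⟩
    obtain ⟨S, hS, hSρ⟩ := exists_finset_initialSet s ρ
    refine ⟨S, by omega, Set.eq_univ_of_forall fun v => ?_⟩
    rw [hSρ]
    exact colored_mono _ _ (by omega) (h v)

theorem decidableInPolyTime_structuralCondition (t : ℕ) :
    DecidableInPolyTime fun I => StructuralCondition t I.2 := by
  have h : ∀ s < t + 1, Definable (q := 2 * t + 1) 0 fun I _ =>
      ∃ ρ : Fin (2 * t + 1) → Fin (I.1 + 1),
        ∀ v, v ∈ colored I.2 (initialSet s ρ) (t - s) := by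
    intro s hs
    have hsq : s < 2 * t + 1 := by omega
    have h₁ := ((definable_colored (q := 2 * t + 1) s (t - s) (d := s + 1) ⟨s, hsq⟩ (by omega)
      (Nat.lt_succ_self s) (by omega)).all hsq).ex_prefix (by omega)
    refine h₁.congr fun I ρ => ?_
    simp only [initialSet_update le_rfl, Function.update_self]
    constructor
    · rintro ⟨ρ', -, h⟩
      exact ⟨ρ', h⟩
    · rintro ⟨ρ', h⟩
      refine ⟨fun j => if s ≤ j.val then ρ j else ρ' j, fun j hj => by simp [hj], ?_⟩
      have : initialSet s (fun j => if s ≤ j.val then ρ j else ρ' j) = initialSet s ρ' := by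
        ext w
        refine exists_congr fun j => and_congr_right fun hj => ?_
        dsimp only
        rw [if_neg (by omega)]
      rwa [this]
  exact ((Definable.exists_lt (t + 1) (φ := fun s I _ => ∃ ρ : Fin (2 * t + 1) → Fin (I.1 + 1),
    ∀ v, v ∈ colored I.2 (initialSet s ρ) (t - s)) h).congr (ψ := fun I _ =>
      StructuralCondition t I.2) fun I _ =>
    (structuralCondition_iff_exists_initialSet I (by omega)).symm).decidableInPolyTime

end Definability

end PowerDom

theorem theorem4p6 (t : ℕ) (ht : 0 < t) :
    (∀ (V : Type*) [Fintype V] [Nonempty V] (G : SimpleGraph V),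
      PowerDom.throttlingNumber G ≤ t ↔ PowerDom.StructuralCondition t G) ∧
    PowerDom.DecidableInPolyTime (fun I => PowerDom.StructuralCondition t I.2) := by
  exact ⟨fun V _ _ G => PowerDom.throttlingNumber_le_iff_structuralCondition t,
    PowerDom.decidableInPolyTime_structuralCondition t⟩
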